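/- Let $J\subset\mathbf R$ be an interval. A knot sequence in $J$ is a set $\mathbf a\subset J$ with at least three elements, with no cluster point in $J$, and with $\inf\mathbf a=\inf J$, $\sup\mathbf a=\sup J$ in $[-\infty,\infty]$. For $a\in\mathbf a$ put $a_+=\inf\{b\in\mathbf a: b>a\}$ and $a_-=\sup\{b\in\mathbf a: b<a\}$ (with $\inf\emptyset=\infty$, $\sup\emptyset=-\infty$). For $\Phi\subset L^2(J)$ let $\Phi_{[u,v]}$ be the set of members of $\Phi$ with support in $[u,v]$, and put $\breve\Phi_a=\Phi_{[a,a_+]}$, $\Phi_a=\Phi_{[a_-,a_+]}\setminus\breve\Phi_{a_-}$, $\bar\Phi_a=\Phi_a\setminus\breve\Phi_a$, where $\breve\Phi_{-\infty}=\bar\Phi_{\infty}=\emptyset$. The set $\Phi$ is a basis centered on $\mathbf a$ if (a) on each compact interval in $J$ all but finitely many members of $\Phi$ vanish; (b) $\Phi=\bigcup_{a\in\mathbf a}\Phi_a$; (c) for each $a\in\mathbf a$ the restrictions to $[a,a_+]$ of the members of $\Phi_a\cup\bar\Phi_{a_+}$ are linearly independent. Let $S(\Phi)$ be the closure in $L^2(J)$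 of the linear span of $\Phi$. On $\mathbf R$ let $r(x)=x\chi_{[0,1)}(x)$, $l(x)=(1-x)\chi_{[0,1)}(x)$ and, for $i\ge 2$, $\tilde\phi^i(x)=x(1-x)p_{i-2}(2x-1)\chi_{[0,1)}(x)$, where $p_j$ is the monic ultraspherical (Gegenbauer) polynomial of degree $j$ with parameter $5/2$ (orthogonal on $[-1,1]$ for the weight $(1-x^2)^2$). For $n\ge 1$ let $$\alpha_n=-\frac{n+1}{2n+5}+\frac{n+3}{2n+5}\sqrt{\frac{3(n+1)(n+3)}{(2n+7)(2n+3)}},\qquad z^n=\alpha_n\tilde\phi^{n+1}+\tilde\phi^{n+3},$$ let $P_n$ be the orthogonal projection in $L^2(\mathbf R)$ onto $\mathrm{span}\{\tilde\phi^2,\dots,\tilde\phi^n,z^n\}$, and let $r^n=(I-P_n)r$, $l^n=(I-P_n)l$. Let $\mathbf a$ be a knot sequence in $J$. For $a\in\mathbf a$ with $a<\sup J$ and a function $f$ let $f_a=f\circ\sigma_a$, where $\sigma_a$ is the affine map with $\sigma_a(a)=0$, $\sigma_a(a_+)=1$. Let $\Omega^n_{\mathbf a}\subset L^2(J)$ consist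 of: the functions $z^n_a,\tilde\phi^2_a,\dots,\tilde\phi^n_a$ for all $a\in\mathbf a$ with $a<\sup J$; the function $l^n_a$ if $a=\inf J\in\mathbf a$; the function $r^n_a$ if $a_+=\sup J$ for some $a\in\mathbf a$ with $a<\sup J$; and the functions $r^n_{a_-}+l^n_a$ for all $a\in\mathbf a$ with $\inf J<a<\sup J$. **Proposition.** Let $J$ be an interval, $\mathbf a$ a knot sequence in $J$, $\kappa\in\{1,2,3\}$, and $V^k=S(\Omega^{3k+\kappa}_{\mathbf a})$ for $k=0,1,2,\dots$. Then: 1. $V^k\subset V^{k+1}$ for all $k\ge0$. 2. For every $k\ge0$, $\Omega^{3k+\kappa}_{\mathbf a}$ is a basis centered on $\mathbf a$, its distinct members are orthogonal in $L^2(J)$, and each of its members agrees almost everywhere with a continuous function on $J$ that is a polynomial of degree at most $3k+\kappa+3$ on each interval $(a,a_+)$, $a\in\mathbf a$, $a<\sup J$. 3. $\bigcup_{k=0}^\infty V^k$ is dense in $L^2(J)$. -/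

import Mathlib

open MeasureTheory Polynomial

/-! ### Knot sequences -/

/-- `a` is a knot sequence in `J`: a subset of `J` with no cluster point in `J`, with the same
infimum and supremum as `J` (in the extended reals), and with at least three elements. -/
structure IsKnotSequence (J a : Set ℝ) : Prop where
  subset : a ⊆ J
  no_cluster : ∀ x ∈ J, ¬ AccPt x (Filter.principal a)
  inf_eq : sInf ((fun x : ℝ => (x : EReal)) '' a) = sInf ((fun x : ℝ => (x : EReal)) '' J)
  sup_eq : sSup ((fun x : ℝ => (x : EReal)) '' a) = sSup ((fun x : ℝ => (x : EReal)) '' J)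
  three_le : 3 ≤ a.encard

/-- The successor `x₊ = inf {b ∈ a | x < b}`; it is `+∞` if there is no larger knot. -/
noncomputable def knotSucc (a : Set ℝ) (x : EReal) : EReal :=
  sInf ((fun b : ℝ => (b : EReal)) '' {b | b ∈ a ∧ x < (b : EReal)})

/-- The predecessor `x₋ = sup {b ∈ a | b < x}`; it is `-∞` if there is no smaller knot. -/
noncomputable def knotPred (a : Set ℝ) (x : EReal) : EReal :=
  sSup ((fun b : ℝ => (b : EReal)) '' {b | b ∈ a ∧ (b : EReal) < x})

/-! ### Bases centered on a knot sequence -/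

/-- The (real) Hilbert space `L²(J)`. -/
abbrev L2On (J : Set ℝ) : Type := Lp ℝ 2 (volume.restrict J)

/-- The real points of the extended interval `[u, v]`. -/
def realIcc (u v : EReal) : Set ℝ := {t : ℝ | u ≤ (t : EReal) ∧ (t : EReal) ≤ v}

/-- `G_{[u,v]}`: the members of `G` whose (essential) support lies in `[u, v]`, that is, which
vanish almost everywhere on `J` outside of the closed interval `[u, v]`. -/
def supportedIn {J : Set ℝ} (G : Set (L2On J)) (u v : EReal) : Set (L2On J) :=
  {f | f ∈ G ∧ ∀ᵐ t ∂(volume.restrict J), t ∉ realIcc u v → f t = 0}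

/-- `Φ̆_x = Φ_{[x, x₊]}`, with the convention `Φ̆_{-∞} = ∅`. -/
def brevePart {J : Set ℝ} (a : Set ℝ) (Φ : Set (L2On J)) (x : EReal) : Set (L2On J) :=
  {f | x ≠ ⊥ ∧ f ∈ supportedIn Φ x (knotSucc a x)}

/-- `Φ_x = Φ_{[x₋, x₊]} \ Φ̆_{x₋}`. -/
def knotPart {J : Set ℝ} (a : Set ℝ) (Φ : Set (L2On J)) (x : EReal) : Set (L2On J) :=
  supportedIn Φ (knotPred a x) (knotSucc a x) \ brevePart a Φ (knotPred a x)

/-- `Φ̄_x = Φ_x \ Φ̆_x`, with the convention `Φ̄_{+∞} = ∅`. -/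
def barPart {J : Set ℝ} (a : Set ℝ) (Φ : Set (L2On J)) (x : EReal) : Set (L2On J) :=
  {f | x ≠ ⊤ ∧ f ∈ knotPart a Φ x \ brevePart a Φ x}

/-- Restriction of an element of `L²(J)` to `J ∩ K`. -/
noncomputable def restrictTo {J : Set ℝ} (K : Set ℝ) (f : L2On J) :
    Lp ℝ 2 ((volume.restrict J).restrict K) :=
  ((Lp.memLp f).restrict K).toLp f

/-- `Φ ⊆ L²(J)` is a basis centered on the knot sequence `a`. -/
structure IsCenteredBasis {J : Set ℝ} (a : Set ℝ) (Φ : Set (L2On J)) : Prop where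
  /-- On a compact interval in `J` all but finitely many members of `Φ` vanish. -/
  locallyFinite : ∀ c d : ℝ, Set.Icc c d ⊆ J →
    {f | f ∈ Φ ∧ ¬ ∀ᵐ t ∂(volume.restrict (Set.Icc c d)), f t = 0}.Finite
  eq_iUnion : Φ = ⋃ x ∈ a, knotPart a Φ (x : EReal)
  /-- The restrictions of `Φ_x ∪ Φ̄_{x₊}` to `[x, x₊]` are linearly independent. -/
  locallyIndependent : ∀ x ∈ a, LinearIndependent ℝ
    (fun f : ↥(knotPart a Φ (x : EReal) ∪ barPart a Φ (knotSucc a x)) =>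
      restrictTo (realIcc x (knotSucc a x)) (f : L2On J))

/-- `S(Φ)`: the closed linear span of `Φ` in `L²(J)`. -/
noncomputable def closedSpan {J : Set ℝ} (Φ : Set (L2On J)) : Submodule ℝ (L2On J) :=
  (Submodule.span ℝ Φ).topologicalClosure

/-- The space `S_d^0(a)` of the elements of `L²(J)` that are continuous on `J` (have a
continuous representative) and are polynomials of degree at most `d` between consecutive knots. -/
def splineSpace (J a : Set ℝ) (d : ℕ) : Set (L2On J) :=
  {f | ∃ g : ℝ → ℝ, ContinuousOn g J ∧ (∀ᵐ t ∂(volume.restrict J), f t = g t) ∧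
    ∀ x ∈ a, ∃ p : ℝ[X], p.natDegree ≤ d ∧
      ∀ t ∈ J, x < t → (t : EReal) < knotSucc a x → g t = p.eval t}

/-! ### The generating functions on the unit interval -/

/-- The monic ultraspherical (Gegenbauer) polynomials with parameter `lam > 0`, given by their
three term recurrence
`p_{i+2} = X p_{i+1} - (i+1)(i+2 lam) / (4 (i+1+lam)(i+lam)) p_i`. They are the monic orthogonal
polynomials for the weight `(1 - x²)^(lam - 1/2)` on `[-1, 1]`. -/
noncomputable def ultraspherical (lam : ℝ) : ℕ → ℝ[X]
  | 0 => 1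
  | 1 => X
  | i + 2 => X * ultraspherical lam (i + 1)
      - C (((i : ℝ) + 1) * (i + 2 * lam) / (4 * (i + 1 + lam) * (i + lam))) * ultraspherical lam i

theorem memLp_unitPoly (p : ℝ[X]) :
    MemLp ((Set.Ico (0 : ℝ) 1).indicator fun t => p.eval t) 2 volume := by
  obtain ⟨c, hc⟩ := (isCompact_Icc (a := (0 : ℝ)) (b := 1)).exists_bound_of_continuousOn
    p.continuous.continuousOn
  rw [memLp_indicator_iff_restrict measurableSet_Ico]
  refine MemLp.of_bound p.continuous.aestronglyMeasurable c ?_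
  exact (ae_restrict_mem measurableSet_Ico).mono fun t ht => hc t (Set.Ico_subset_Icc_self ht)

/-- The element `p · χ_{[0,1)}` of `L²(ℝ)`. -/
noncomputable def unitPoly (p : ℝ[X]) : Lp ℝ 2 (volume : Measure ℝ) :=
  (memLp_unitPoly p).toLp _

/-- `φ̃^i(x) = x (1 - x) p_{i-2}^{5/2}(2x - 1) χ_{[0,1)}(x)`, for `i ≥ 2`. -/
noncomputable def bump (i : ℕ) : Lp ℝ 2 (volume : Measure ℝ) :=
  unitPoly (X * (1 - X) * (ultraspherical (5 / 2) (i - 2)).comp (2 * X - 1))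

/-- `r(x) = x χ_{[0,1)}(x)`. -/
noncomputable def ramp : Lp ℝ 2 (volume : Measure ℝ) := unitPoly X

/-- `l(x) = (1 - x) χ_{[0,1)}(x)`. -/
noncomputable def coramp : Lp ℝ 2 (volume : Measure ℝ) := unitPoly (1 - X)

/-- The coefficient `α_n`. -/
noncomputable def alphaCoeff (n : ℕ) : ℝ :=
  -((n : ℝ) + 1) / (2 * n + 5)
    + ((n : ℝ) + 3) / (2 * n + 5)
      * Real.sqrt (3 * ((n : ℝ) + 1) * (n + 3) / ((2 * n + 7) * (2 * n + 3)))

/-- `z^n = α_n φ̃^{n+1} + φ̃^{n+3}`. -/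
noncomputable def zFun (n : ℕ) : Lp ℝ 2 (volume : Measure ℝ) :=
  alphaCoeff n • bump (n + 1) + bump (n + 3)

/-- The span of `φ̃^2, …, φ̃^n, z^n`. -/
noncomputable def innerSpan (n : ℕ) : Submodule ℝ (Lp ℝ 2 (volume : Measure ℝ)) :=
  Submodule.span ℝ (insert (zFun n) (bump '' Set.Icc 2 n))

instance finiteDimensional_innerSpan (n : ℕ) : FiniteDimensional ℝ (innerSpan n) :=
  FiniteDimensional.span_of_finite ℝ (((Set.finite_Icc 2 n).image bump).insert (zFun n))

/-- `r^n = (I - P) r`, with `P` the orthogonal projection onto the span of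
`φ̃^2, …, φ̃^n, z^n`. -/
noncomputable def rFun (n : ℕ) : Lp ℝ 2 (volume : Measure ℝ) :=
  ramp - (innerSpan n).starProjection ramp

/-- `l^n = (I - P) l`, with the same `P`. -/
noncomputable def lFun (n : ℕ) : Lp ℝ 2 (volume : Measure ℝ) :=
  coramp - (innerSpan n).starProjection coramp

/-! ### The bases `Ω^n` -/

theorem memLp_comp_affine (J : Set ℝ) (f : Lp ℝ 2 (volume : Measure ℝ)) {x y : ℝ} (h : x < y) :
    MemLp (fun t : ℝ => f ((t - x) / (y - x))) 2 (volume.restrict J) := by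
  have hc : (y - x)⁻¹ ≠ 0 := inv_ne_zero (sub_pos.2 h).ne'
  have hm : Measurable fun t : ℝ => (t - x) / (y - x) := by fun_prop
  have hmap : Measure.map (fun t : ℝ => (t - x) / (y - x)) volume
      = ENNReal.ofReal |(y - x)⁻¹⁻¹| • (volume : Measure ℝ) := by
    have : (fun t : ℝ => (t - x) / (y - x)) = (fun t => t * (y - x)⁻¹) ∘ (fun t => t + (-x)) := by
      funext t
      simp [div_eq_mul_inv, sub_eq_add_neg]
    rw [this, ← Measure.map_map (by fun_prop) (by fun_prop), map_add_right_eq_self,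
      Real.map_volume_mul_right hc]
  have h1 : MemLp f 2 (Measure.map (fun t : ℝ => (t - x) / (y - x)) volume) := by
    rw [hmap]
    exact (Lp.memLp f).smul_measure ENNReal.ofReal_ne_top
  exact (h1.comp_of_map hm.aemeasurable).restrict J

open scoped Classical in
/-- `f ∘ σ` as an element of `L²(J)`, where `σ` is the affine map taking `x` to `0` and `y` to
`1`, for `x < y` (and `0`, never used, if `y ≤ x`). -/
noncomputable def placeOn (J : Set ℝ) (f : Lp ℝ 2 (volume : Measure ℝ)) (x y : ℝ) : L2On J :=
  if h : x < y then (memLp_comp_affine J f h).toLp _ else 0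

/-- `f_x = f ∘ σ_x`, where `σ_x` takes the knot `x` to `0` and its successor `x₊` to `1`. -/
noncomputable def onKnot (J a : Set ℝ) (f : Lp ℝ 2 (volume : Measure ℝ)) (x : ℝ) : L2On J :=
  placeOn J f x (knotSucc a x).toReal

/-- The functions of `Ω^n` placed on `[x, x₊]`, for a knot `x < sup J`:
`z^n_x, φ̃^2_x, …, φ̃^n_x`, together with `l^n_x` if `x = inf J`, and with `r^n_x` if
`x₊ = sup J`. (As there are at least three knots, the last two cases exclude each other.) -/
def omegaBreve (J a : Set ℝ) (n : ℕ) (x : ℝ) : Set (L2On J) :=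
  {f | f = onKnot J a (zFun n) x
    ∨ (∃ i, 2 ≤ i ∧ i ≤ n ∧ f = onKnot J a (bump i) x)
    ∨ ((x : EReal) = sInf ((fun t : ℝ => (t : EReal)) '' J) ∧ f = onKnot J a (lFun n) x)
    ∨ (knotSucc a x = sSup ((fun t : ℝ => (t : EReal)) '' J) ∧ f = onKnot J a (rFun n) x)}

/-- The function `r^n_{x₋} + l^n_x` of `Ω^n`, for a knot `x` with `inf J < x < sup J`. -/
noncomputable def omegaBar (J a : Set ℝ) (n : ℕ) (x : ℝ) : L2On J :=
  onKnot J a (rFun n) (knotPred a x).toReal + onKnot J a (lFun n) x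

/-- The set `Ω^n_a ⊆ L²(J)`. -/
def omegaBasis (J a : Set ℝ) (n : ℕ) : Set (L2On J) :=
  {f | ∃ x ∈ a, (x : EReal) < sSup ((fun t : ℝ => (t : EReal)) '' J) ∧
    (f ∈ omegaBreve J a n x
      ∨ (sInf ((fun t : ℝ => (t : EReal)) '' J) < (x : EReal) ∧ f = omegaBar J a n x))}

/-! All the analysis happens on one cell, normalised to `[0,1]`; the rest is gluing. With `s = 2x -
1` one has `x(1-x) = (1-s²)/4`, so two bumps are paired by the weight `(1-s²)²`, for which the
polynomials of parameter `5/2` are orthogonal. As `z^n` involves only the bumps of index `n+1` and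
`n+3`, it is orthogonal to those of index at most `n`, and projection makes `l^n` and `r^n`
orthogonal to all of these.

What remains is `l^n ⟂ r^n` (`inner_lFun_rFun`). Pairing a bump with a ramp gives the weight `1-s²`;
the connection formula between the parameters `3/2` and `5/2` turns this into a two-step recursion,
hence a closed form for the squared pairings (`inner_bump_ramp_sq`). The sum expressing the part of
`⟨r,l⟩ = 1/6` carried by the bumps then telescopes (`sum_inner_bump_ramp_coramp`), leaving a
remainder `± 1/((n+1)(n+2)(n+3))` when there are `n` bumps. The number `α` is a root of the
quadratic equation that makes the contribution of `z` equal to this remainder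
(`alphaCoeff_quadratic`).

For the gluing, each member of the basis is described by an `OmegaIndex`, which prescribes on every
cell either zero or one polynomial of a fixed orthogonal family on `[0,1]`. On a given cell
different indices never select the same polynomial, so distinct members are orthogonal on each cell
separately (`setIntegral_mul_eq_zero`). This yields global orthogonality and also the linear
independence of restrictions. The values of `l^n` and `r^n` at the ends of `[0,1]`, and the
vanishing of all other pieces there, give continuity.

The spaces are nested with step three because `z^n` lies in the span of the bumps up to index `n+3`;
enlarging the span onto which one projects changes `l^n` and `r^n` by an element of the larger span.
For density, a function orthogonal to every space is, on each cell, orthogonal to `x(1-x)` times any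
polynomial, hence zero by Weierstrass approximation. -/

/-! ### Recurrence and structure relation for ultraspherical polynomials -/

theorem ultraspherical_eval_add_two (lam : ℝ) (n : ℕ) (s : ℝ) :
    (ultraspherical lam (n + 2)).eval s = s * (ultraspherical lam (n + 1)).eval s
      - (((n : ℝ) + 1) * (n + 2 * lam) / (4 * (n + 1 + lam) * (n + lam)))
        * (ultraspherical lam n).eval s := by
  simp [ultraspherical]

theorem ultraspherical_monic_natDegree (lam : ℝ) (n : ℕ) :
    (ultraspherical lam n).Monic ∧ (ultraspherical lam n).natDegree = n := by
  induction n using Nat.strong_induction_on with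
  | _ n ih =>
    match n with
    | 0 => simp [ultraspherical]
    | 1 => simp [ultraspherical, monic_X]
    | n + 2 =>
      obtain ⟨hm, hd⟩ := ih (n + 1) (by omega)
      obtain ⟨-, hd'⟩ := ih n (by omega)
      have hX : (X * ultraspherical lam (n + 1)).Monic := monic_X.mul hm
      have hXd : (X * ultraspherical lam (n + 1)).natDegree = n + 2 := by
        rw [natDegree_X_mul hm.ne_zero, hd]
      rw [ultraspherical]
      generalize ((n : ℝ) + 1) * (n + 2 * lam) / (4 * (n + 1 + lam) * (n + lam)) = c
      have hlt : (C c * ultraspherical lam n).natDegree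
          < (X * ultraspherical lam (n + 1)).natDegree := by
        have := natDegree_C_mul_le c (ultraspherical lam n)
        omega
      exact ⟨hX.sub_of_left (degree_lt_degree hlt),
        by rw [natDegree_sub_eq_left_of_natDegree_lt hlt, hXd]⟩

/-- The structure relation `(1 - s²) p' = -(n+1) s p + e q` for consecutive ultraspherical
polynomials. -/
theorem ultraspherical_structure {lam : ℝ} (hl : 0 < lam) (n : ℕ) (s : ℝ) :
    (1 - s ^ 2) * (derivative (ultraspherical lam (n + 1))).eval s
      = -(n + 1) * s * (ultraspherical lam (n + 1)).eval s
        + ((n : ℝ) + 1) * (n + 2 * lam) / (2 * (n + lam)) * (ultraspherical lam n).eval s := by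
  induction n using Nat.strong_induction_on with
  | _ n ih =>
    match n with
    | 0 => simp [ultraspherical]; field_simp; ring
    | 1 =>
      simp [ultraspherical]; field_simp; ring
    | n + 2 =>
      have h1 := ih (n + 1) (by omega)
      have h0 := ih n (by omega)
      have r3 := ultraspherical_eval_add_two lam (n + 1) s
      have r2 := ultraspherical_eval_add_two lam n s
      have hd : (derivative (ultraspherical lam (n + 3))).eval s
          = (ultraspherical lam (n + 2)).eval s
            + s * (derivative (ultraspherical lam (n + 2))).eval s
            - (((n + 1 : ℕ) : ℝ) + 1) * ((n + 1 : ℕ) + 2 * lam)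
              / (4 * ((n + 1 : ℕ) + 1 + lam) * ((n + 1 : ℕ) + lam))
              * (derivative (ultraspherical lam (n + 1))).eval s := by
        rw [show n + 3 = (n + 1) + 2 from rfl, ultraspherical]
        simp
      rw [show n + 2 + 1 = n + 3 from rfl] at *
      rw [show n + 1 + 2 = n + 3 from rfl] at *
      rw [show n + 1 + 1 = n + 2 from rfl] at *
      generalize (ultraspherical lam (n + 3)).eval s = p3 at *
      generalize (ultraspherical lam (n + 2)).eval s = p2 at *
      generalize (ultraspherical lam (n + 1)).eval s = p1 at *
      generalize (ultraspherical lam n).eval s = p0 at *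
      generalize (derivative (ultraspherical lam (n + 3))).eval s = d3 at *
      generalize (derivative (ultraspherical lam (n + 2))).eval s = d2 at *
      generalize (derivative (ultraspherical lam (n + 1))).eval s = d1 at *
      push_cast at *
      have e : (1 - s ^ 2) * d3 = (1 - s ^ 2) * p2 + s * ((1 - s ^ 2) * d2)
          - ((n : ℝ) + 1 + 1) * (n + 1 + 2 * lam)
              / (4 * (n + 1 + 1 + lam) * (n + 1 + lam)) * ((1 - s ^ 2) * d1) := by
        rw [hd]; ring
      rw [e, h1, h0, r3]
      -- The recurrence eliminates the polynomial of lowest index, so that only those of index `n+1`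
      -- and `n+2` remain.
      have hp0 : ((n : ℝ) + 1) * (n + 2 * lam) / (2 * (n + lam)) * p0
          = 2 * (n + 1 + lam) * (s * p1 - p2) := by
        rw [r2]; field_simp; ring
      rw [hp0]
      field_simp
      ring

/-! ### Orthogonality of ultraspherical polynomials for half-integer parameters -/

/-- The functional `p ↦ ∫ (1 - s²)^k p(s) ds` over `[-1, 1]`. -/
noncomputable def gegenbauerInt (k : ℕ) : ℝ[X] →ₗ[ℝ] ℝ where
  toFun p := ∫ s in (-1 : ℝ)..1, (1 - s ^ 2) ^ k * p.eval s
  map_add' p q := by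
    simp only [eval_add, mul_add]
    exact intervalIntegral.integral_add (Continuous.intervalIntegrable (by fun_prop) _ _)
      (Continuous.intervalIntegrable (by fun_prop) _ _)
  map_smul' c p := by
    simp only [eval_smul, smul_eq_mul, RingHom.id_apply]
    rw [← intervalIntegral.integral_const_mul]
    congr 1; ext; ring

theorem gegenbauerInt_apply (k : ℕ) (p : ℝ[X]) :
    gegenbauerInt k p = ∫ s in (-1 : ℝ)..1, (1 - s ^ 2) ^ k * p.eval s := rfl

theorem integral_derivative_eval (p : ℝ[X]) (a b : ℝ) :
    ∫ s in a..b, (derivative p).eval s = p.eval b - p.eval a :=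
  intervalIntegral.integral_eq_sub_of_hasDerivAt (fun s _ => p.hasDerivAt s)
    ((derivative p).continuous.intervalIntegrable _ _)

/-- Multiplied by `(1-s²)^k`, the polynomial `q` is the derivative of `(1-s²)^(k+1) p`, which
vanishes at both ends. -/
theorem gegenbauerInt_eq_zero_of_derivative (k : ℕ) (p q : ℝ[X])
    (h : ∀ s, q.eval s = (1 - s ^ 2) * (derivative p).eval s - (2 * k + 2) * s * p.eval s) :
    gegenbauerInt k q = 0 := by
  have := integral_derivative_eval ((1 - X ^ 2) ^ (k + 1) * p) (-1) 1
  simp only [eval_mul, eval_pow, eval_sub, eval_one, eval_X] at this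
  norm_num at this
  rw [gegenbauerInt_apply, ← this]
  congr 1; ext s
  rw [h]
  simp [derivative_pow]
  ring

/-- The parameter `k + 1/2` belongs to the weight `(1-s²)^k`. This is orthogonality to constants,
from which full orthogonality follows by the recurrence. -/
theorem gegenbauerInt_ultraspherical (k n : ℕ) :
    gegenbauerInt k (ultraspherical (k + 1 / 2) (n + 1)) = 0 := by
  have hl : (0 : ℝ) < k + 1 / 2 := by positivity
  induction n using Nat.strong_induction_on with
  | _ n ih =>
    match n with
    | 0 =>
      have := gegenbauerInt_eq_zero_of_derivative k 1
        ((-(2 * k + 2) : ℝ) • ultraspherical (k + 1 / 2) 1) (by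
          intro s; simp [ultraspherical]; ring)
      rw [map_smul, smul_eq_mul, mul_eq_zero] at this
      exact this.resolve_left (by have : (0 : ℝ) ≤ k := by positivity
                                  linarith)
    | n + 1 =>
      set P := ultraspherical ((k : ℝ) + 1 / 2) with hP
      -- A total derivative built from `P (n + 1)` reduces the integral of `P (n + 2)` to that of `P
      -- n`. For `n = 0` the latter is not zero, so the coefficient `e` itself has to vanish.
      obtain ⟨e, he, he0⟩ : ∃ e : ℝ, gegenbauerInt k (-(n + 1 + 2 * k + 2 : ℝ) • P (n + 2)
          + e • P n) = 0 ∧ (n = 0 → e = 0) := by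
        refine ⟨((n : ℝ) + 1) * (n + 2 * (k + 1 / 2)) / (2 * (n + (k + 1 / 2)))
          - (n + 1 + 2 * k + 2) * (((n : ℝ) + 1) * (n + 2 * (k + 1 / 2))
            / (4 * (n + 1 + (k + 1 / 2)) * (n + (k + 1 / 2)))),
          gegenbauerInt_eq_zero_of_derivative k (P (n + 1)) _ fun s => ?_, ?_⟩
        · rw [ultraspherical_structure hl, eval_add, eval_smul, eval_smul,
            ultraspherical_eval_add_two]
          simp only [smul_eq_mul]
          ring
        · rintro rfl
          field_simp
          push_cast
          ring
      rw [map_add, map_smul, map_smul] at he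
      have : e • gegenbauerInt k (P n) = 0 := by
        match n, ih, he0 with
        | 0, _, h => rw [h rfl, zero_smul]
        | n + 1, ih, _ => rw [ih n (by omega), smul_zero]
      rw [this, add_zero, smul_eq_mul, mul_eq_zero] at he
      exact he.resolve_left (by have : (0 : ℝ) ≤ k := by positivity
                                have : (0 : ℝ) ≤ n := by positivity
                                linarith)

theorem X_mul_ultraspherical (lam : ℝ) (n : ℕ) :
    X * ultraspherical lam (n + 1) = ultraspherical lam (n + 2)
      + (((n : ℝ) + 1) * (n + 2 * lam) / (4 * (n + 1 + lam) * (n + lam))) •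
        ultraspherical lam n := by
  rw [ultraspherical, smul_eq_C_mul]; ring

/-- By the recurrence each factor `X` lowers the index by at most one, so `m < n` factors never
reach index `0`. -/
theorem gegenbauerInt_ultraspherical_mul_X_pow (k m : ℕ) : ∀ n, m < n →
    gegenbauerInt k (ultraspherical (k + 1 / 2) n * X ^ m) = 0 := by
  induction m with
  | zero =>
    intro n hn
    obtain ⟨n, rfl⟩ := Nat.exists_eq_succ_of_ne_zero hn.ne'
    simpa using gegenbauerInt_ultraspherical k n
  | succ m ih =>
    intro n hn
    obtain ⟨n, rfl⟩ := Nat.exists_eq_succ_of_ne_zero (by omega : n ≠ 0)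
    rw [pow_succ', ← mul_assoc, mul_comm _ X, X_mul_ultraspherical, add_mul, map_add,
      ih (n + 2) (by omega), smul_mul_assoc, map_smul, ih n (by omega)]
    simp

theorem gegenbauerInt_ultraspherical_mul_eq_zero (k n : ℕ) (q : ℝ[X]) (hq : q.natDegree < n) :
    gegenbauerInt k (ultraspherical (k + 1 / 2) n * q) = 0 := by
  rw [q.as_sum_range' n hq, Finset.mul_sum, map_sum]
  refine Finset.sum_eq_zero fun m hm => ?_
  rw [← C_mul_X_pow_eq_monomial, ← smul_eq_C_mul, mul_smul_comm, map_smul,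
    gegenbauerInt_ultraspherical_mul_X_pow k m n (Finset.mem_range.1 hm), smul_zero]

theorem gegenbauerInt_ultraspherical_mul_of_ne (k : ℕ) {i j : ℕ} (h : i ≠ j) :
    gegenbauerInt k (ultraspherical (k + 1 / 2) i * ultraspherical (k + 1 / 2) j) = 0 := by
  rcases h.lt_or_gt with h | h
  · rw [mul_comm]
    exact gegenbauerInt_ultraspherical_mul_eq_zero k j _
      (by rwa [(ultraspherical_monic_natDegree _ i).2])
  · exact gegenbauerInt_ultraspherical_mul_eq_zero k i _
      (by rwa [(ultraspherical_monic_natDegree _ j).2])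

/-- One factor `P (n+1)` may be replaced by `X * P n`, up to lower order terms; moving `X` to the
other factor leaves the recurrence coefficient. -/
theorem gegenbauerInt_ultraspherical_sq_succ (k n : ℕ) :
    gegenbauerInt k (ultraspherical (k + 1 / 2) (n + 1) * ultraspherical (k + 1 / 2) (n + 1))
      = (((n : ℝ) + 1) * (n + 2 * (k + 1 / 2))
          / (4 * (n + 1 + (k + 1 / 2)) * (n + (k + 1 / 2))))
        * gegenbauerInt k (ultraspherical (k + 1 / 2) n * ultraspherical (k + 1 / 2) n) := by
  set P := ultraspherical ((k : ℝ) + 1 / 2) with hP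
  have h1 : gegenbauerInt k (P (n + 1) * P (n + 1)) = gegenbauerInt k (P (n + 1) * (X * P n)) := by
    rw [← sub_eq_zero, ← map_sub, ← mul_sub]
    match n with
    | 0 => simp [hP, ultraspherical]
    | n + 1 =>
      have : P (n + 1 + 1) - X * P (n + 1) = -((((n : ℝ) + 1) * (n + 2 * (k + 1 / 2))
          / (4 * (n + 1 + (k + 1 / 2)) * (n + (k + 1 / 2)))) • P n) := by
        rw [hP, X_mul_ultraspherical]; ring
      rw [this, mul_neg, map_neg, mul_smul_comm, map_smul,
        gegenbauerInt_ultraspherical_mul_of_ne k (by omega), smul_zero, neg_zero]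
  rw [h1, show P (n + 1) * (X * P n) = (X * P (n + 1)) * P n by ring, X_mul_ultraspherical,
    add_mul, map_add, gegenbauerInt_ultraspherical_mul_of_ne k (by omega), zero_add,
    smul_mul_assoc, map_smul, smul_eq_mul]

/-- The connection formula between the ultraspherical polynomials of parameters `3/2`
and `5/2`. -/
theorem ultraspherical_connection (n : ℕ) (s : ℝ) :
    (ultraspherical (3 / 2) (n + 2)).eval s = (ultraspherical (5 / 2) (n + 2)).eval s
      - ((n : ℝ) + 2) * (n + 1) / ((2 * n + 7) * (2 * n + 5))
        * (ultraspherical (5 / 2) n).eval s := by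
  induction n using Nat.strong_induction_on with
  | _ n ih =>
    match n with
    | 0 => simp [ultraspherical]; ring
    | 1 => simp [ultraspherical]; ring
    | n + 2 =>
      have h1 := ih (n + 1) (by omega)
      have h0 := ih n (by omega)
      rw [ultraspherical_eval_add_two, h0, h1, ultraspherical_eval_add_two (5 / 2) (n + 2),
        show n + 1 + 2 = n + 2 + 1 from rfl, ultraspherical_eval_add_two (5 / 2) n]
      push_cast
      field_simp
      ring

/-- The polynomial of parameter `3/2` and index `n+2` is orthogonal to degree at most one for the
weight `1-s²`; expanding it by the connection formula gives the recursion. Ramps correspond to `1 ±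
X`, whence the degree bound. -/
theorem gegenbauerInt_one_connection (n : ℕ) (q : ℝ[X]) (hq : q.natDegree ≤ 1) :
    gegenbauerInt 1 (ultraspherical (5 / 2) (n + 2) * q)
      = ((n : ℝ) + 2) * (n + 1) / ((2 * n + 7) * (2 * n + 5))
        * gegenbauerInt 1 (ultraspherical (5 / 2) n * q) := by
  have h := gegenbauerInt_ultraspherical_mul_eq_zero 1 (n + 2) q (by omega)
  have e : ultraspherical ((1 : ℕ) + 1 / 2) (n + 2) = ultraspherical (5 / 2) (n + 2)
      - (((n : ℝ) + 2) * (n + 1) / ((2 * n + 7) * (2 * n + 5))) • ultraspherical (5 / 2) n := by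
    refine Polynomial.funext fun s => ?_
    rw [show ((1 : ℕ) + 1 / 2 : ℝ) = 3 / 2 by norm_num, ultraspherical_connection]
    simp
  rw [e, sub_mul, map_sub, smul_mul_assoc, map_smul, smul_eq_mul] at h
  linarith

/-! ### Inner products of bumps and ramps on the unit interval -/

theorem coeFn_unitPoly (p : ℝ[X]) :
    unitPoly p =ᵐ[volume] (Set.Ico (0 : ℝ) 1).indicator fun t => p.eval t :=
  (memLp_unitPoly p).coeFn_toLp

theorem unitPoly_add (p q : ℝ[X]) : unitPoly (p + q) = unitPoly p + unitPoly q := by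
  apply Lp.ext
  filter_upwards [coeFn_unitPoly (p + q), coeFn_unitPoly p, coeFn_unitPoly q,
    Lp.coeFn_add (unitPoly p) (unitPoly q)] with t h1 h2 h3 h4
  rw [h1, h4, Pi.add_apply, h2, h3]
  by_cases ht : t ∈ Set.Ico (0 : ℝ) 1 <;> simp [ht]

theorem unitPoly_smul (c : ℝ) (p : ℝ[X]) : unitPoly (c • p) = c • unitPoly p := by
  apply Lp.ext
  filter_upwards [coeFn_unitPoly (c • p), coeFn_unitPoly p,
    Lp.coeFn_smul c (unitPoly p)] with t h1 h2 h4
  rw [h1, h4, Pi.smul_apply, h2]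
  by_cases ht : t ∈ Set.Ico (0 : ℝ) 1 <;> simp [ht]

theorem unitPoly_sub (p q : ℝ[X]) : unitPoly (p - q) = unitPoly p - unitPoly q := by
  rw [sub_eq_add_neg, unitPoly_add, ← neg_one_smul ℝ q, unitPoly_smul, neg_one_smul,
    ← sub_eq_add_neg]

theorem inner_unitPoly (p q : ℝ[X]) :
    inner ℝ (unitPoly p) (unitPoly q) = ∫ t in (0 : ℝ)..1, (p * q).eval t := by
  rw [L2.inner_def, intervalIntegral.integral_of_le zero_le_one, integral_Ioc_eq_integral_Ioo,
    ← integral_Ico_eq_integral_Ioo, ← integral_indicator measurableSet_Ico]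
  refine integral_congr_ae ?_
  filter_upwards [coeFn_unitPoly p, coeFn_unitPoly q] with t h1 h2
  rw [h1, h2]
  by_cases ht : t ∈ Set.Ico (0 : ℝ) 1 <;> simp [ht, mul_comm]

/-- Substitution `s = 2x - 1`, which contributes the factor `1/2`. -/
theorem integral_unit_eq (k : ℕ) (p q : ℝ[X]) (c : ℝ)
    (h : ∀ s, p.eval s = c * ((1 - (2 * s - 1) ^ 2) ^ k * q.eval (2 * s - 1))) :
    ∫ t in (0 : ℝ)..1, p.eval t = c / 2 * gegenbauerInt k q := by
  simp_rw [h]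
  rw [intervalIntegral.integral_const_mul,
    intervalIntegral.integral_comp_mul_sub (fun s => (1 - s ^ 2) ^ k * q.eval s)
      (by norm_num : (2 : ℝ) ≠ 0) 1, gegenbauerInt_apply]
  norm_num
  ring

theorem inner_bump (i j : ℕ) : inner ℝ (bump (i + 2)) (bump (j + 2))
    = (1 / 32) * gegenbauerInt 2 (ultraspherical (5 / 2) i * ultraspherical (5 / 2) j) := by
  rw [bump, bump, inner_unitPoly, integral_unit_eq 2 _
    (ultraspherical (5 / 2) i * ultraspherical (5 / 2) j) (1 / 16)]
  · norm_num
  · intro s; simp; ring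

theorem inner_bump_ramp (i : ℕ) : inner ℝ (bump (i + 2)) ramp
    = (1 / 16) * gegenbauerInt 1 (ultraspherical (5 / 2) i * (1 + X)) := by
  rw [bump, ramp, inner_unitPoly, integral_unit_eq 1 _
    (ultraspherical (5 / 2) i * (1 + X)) (1 / 8)]
  · norm_num
  · intro s; simp; ring

theorem inner_bump_coramp (i : ℕ) : inner ℝ (bump (i + 2)) coramp
    = (1 / 16) * gegenbauerInt 1 (ultraspherical (5 / 2) i * (1 - X)) := by
  rw [bump, coramp, inner_unitPoly, integral_unit_eq 1 _
    (ultraspherical (5 / 2) i * (1 - X)) (1 / 8)]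
  · norm_num
  · intro s; simp; ring

theorem integral_cubic (p : ℝ[X]) (a b c d : ℝ)
    (h : ∀ s, p.eval s = a * s ^ 3 + b * s ^ 2 + c * s + d) :
    ∫ t in (0 : ℝ)..1, p.eval t = a / 4 + b / 3 + c / 2 + d := by
  have := integral_derivative_eval
    (C (a / 4) * X ^ 4 + C (b / 3) * X ^ 3 + C (c / 2) * X ^ 2 + C d * X) 0 1
  simp at this
  rw [← this]
  congr 1; ext s; rw [h]; ring

theorem inner_ramp_coramp : inner ℝ ramp coramp = (1 / 6 : ℝ) := by
  rw [ramp, coramp, inner_unitPoly, integral_cubic _ 0 (-1) 1 0]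
  · norm_num
  · intro s; simp; ring

theorem inner_bump_of_ne {i j : ℕ} (h : i ≠ j) :
    inner ℝ (bump (i + 2)) (bump (j + 2)) = (0 : ℝ) := by
  have := gegenbauerInt_ultraspherical_mul_of_ne 2 h
  rw [show ((2 : ℕ) + 1 / 2 : ℝ) = 5 / 2 by norm_num] at this
  rw [inner_bump, this, mul_zero]

theorem inner_bump_self (n : ℕ) : inner ℝ (bump (n + 3)) (bump (n + 3))
    = ((n : ℝ) + 1) * (n + 5) / ((2 * n + 7) * (2 * n + 5))
      * (inner ℝ (bump (n + 2)) (bump (n + 2)) : ℝ) := by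
  have := gegenbauerInt_ultraspherical_sq_succ 2 n
  rw [show ((2 : ℕ) + 1 / 2 : ℝ) = 5 / 2 by norm_num] at this
  rw [show n + 3 = n + 1 + 2 from rfl, inner_bump, inner_bump, this]
  field_simp
  ring

theorem inner_bump_ramp_add_two (n : ℕ) : inner ℝ (bump (n + 4)) ramp
    = ((n : ℝ) + 2) * (n + 1) / ((2 * n + 7) * (2 * n + 5))
      * (inner ℝ (bump (n + 2)) ramp : ℝ) := by
  rw [show n + 4 = n + 2 + 2 from rfl, inner_bump_ramp, inner_bump_ramp,
    gegenbauerInt_one_connection n (1 + X) (by compute_degree)]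
  ring

theorem inner_bump_coramp_add_two (n : ℕ) : inner ℝ (bump (n + 4)) coramp
    = ((n : ℝ) + 2) * (n + 1) / ((2 * n + 7) * (2 * n + 5))
      * (inner ℝ (bump (n + 2)) coramp : ℝ) := by
  rw [show n + 4 = n + 2 + 2 from rfl, inner_bump_coramp, inner_bump_coramp,
    gegenbauerInt_one_connection n (1 - X) (by compute_degree)]
  ring

theorem inner_bump_two_ramp : inner ℝ (bump 2) ramp = (1 / 12 : ℝ) := by
  rw [bump, ramp, inner_unitPoly, integral_cubic _ (-1) 1 0 0]
  · norm_num
  · intro s; simp [ultraspherical]; ring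

theorem inner_bump_two_coramp : inner ℝ (bump 2) coramp = (1 / 12 : ℝ) := by
  rw [bump, coramp, inner_unitPoly, integral_cubic _ 1 (-2) 1 0]
  · norm_num
  · intro s; simp [ultraspherical]; ring

theorem integral_quintic (p : ℝ[X]) (a b c d e f : ℝ)
    (h : ∀ s, p.eval s = a * s ^ 5 + b * s ^ 4 + c * s ^ 3 + d * s ^ 2 + e * s + f) :
    ∫ t in (0 : ℝ)..1, p.eval t = a / 6 + b / 5 + c / 4 + d / 3 + e / 2 + f := by
  have := integral_derivative_eval
    (C (a / 6) * X ^ 6 + C (b / 5) * X ^ 5 + C (c / 4) * X ^ 4 + C (d / 3) * X ^ 3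
      + C (e / 2) * X ^ 2 + C f * X) 0 1
  simp at this
  rw [← this]
  congr 1; ext s; rw [h]; ring

theorem inner_bump_three_ramp : inner ℝ (bump 3) ramp = (1 / 60 : ℝ) := by
  rw [bump, ramp, inner_unitPoly, integral_quintic _ 0 (-2) 3 (-1) 0 0]
  · norm_num
  · intro s; simp [ultraspherical]; ring

theorem inner_bump_three_coramp : inner ℝ (bump 3) coramp = (-1 / 60 : ℝ) := by
  rw [bump, coramp, inner_unitPoly, integral_quintic _ 0 2 (-5) 4 (-1) 0]
  · norm_num
  · intro s; simp [ultraspherical]; ring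

theorem inner_bump_two_self : inner ℝ (bump 2) (bump 2) = (1 / 30 : ℝ) := by
  rw [bump, inner_unitPoly, integral_quintic _ 0 1 (-2) 1 0 0]
  · norm_num
  · intro s; simp [ultraspherical]; ring

theorem inner_bump_self_pos (n : ℕ) : (0 : ℝ) < inner ℝ (bump (n + 2)) (bump (n + 2)) := by
  induction n with
  | zero => rw [inner_bump_two_self]; norm_num
  | succ n ih => rw [inner_bump_self]; positivity

/-- The reflection `x ↦ 1 - x` exchanges the ramps and multiplies the bump by `(-1)^n`. Here this is
read off from the common two-step recursion and two initial values. -/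
theorem inner_bump_coramp_eq (n : ℕ) :
    inner ℝ (bump (n + 2)) coramp = (-1) ^ n * (inner ℝ (bump (n + 2)) ramp : ℝ) := by
  induction n using Nat.strong_induction_on with
  | _ n ih =>
    match n with
    | 0 => simp [inner_bump_two_ramp, inner_bump_two_coramp]
    | 1 => rw [inner_bump_three_ramp, inner_bump_three_coramp]; norm_num
    | n + 2 =>
      rw [inner_bump_coramp_add_two, inner_bump_ramp_add_two, ih n (by omega)]
      ring

theorem inner_bump_ramp_sq (n : ℕ) : (inner ℝ (bump (n + 2)) ramp : ℝ) ^ 2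
    = (2 * n + 5) / ((n + 1) * (n + 2) * (n + 3) * (n + 4))
      * (inner ℝ (bump (n + 2)) (bump (n + 2)) : ℝ) := by
  induction n using Nat.strong_induction_on with
  | _ n ih =>
    match n with
    | 0 => rw [inner_bump_two_ramp, inner_bump_two_self]; norm_num
    | 1 => rw [inner_bump_three_ramp, inner_bump_self, inner_bump_two_self]; norm_num
    | n + 2 =>
      rw [inner_bump_ramp_add_two, mul_pow, ih n (by omega), inner_bump_self, inner_bump_self]
      push_cast
      field_simp
      ring

/-- By `inner_bump_ramp_sq` the summand is a rational function of the index with alternating sign,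
and it telescopes. The value `1/6` is `⟨r,l⟩`, so the last term is what remains of it after
projecting out `m` bumps. -/
theorem sum_inner_bump_ramp_coramp (m : ℕ) :
    ∑ j ∈ Finset.range m, (inner ℝ (bump (j + 2)) ramp : ℝ) * inner ℝ (bump (j + 2)) coramp
      / inner ℝ (bump (j + 2)) (bump (j + 2))
    = 1 / 6 - (-1) ^ m / ((m + 1) * (m + 2) * (m + 3)) := by
  induction m with
  | zero => norm_num
  | succ m ih =>
    have h := inner_bump_ramp_sq m
    have hp := inner_bump_self_pos m
    rw [Finset.sum_range_succ, ih, inner_bump_coramp_eq,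
      show (inner ℝ (bump (m + 2)) ramp : ℝ) * ((-1) ^ m * inner ℝ (bump (m + 2)) ramp)
        = (-1) ^ m * (inner ℝ (bump (m + 2)) ramp : ℝ) ^ 2 by ring, h]
    push_cast
    field_simp
    ring

/-! ### The choice of `α_n` and the orthogonality of `l^n` and `r^n` -/

/-- The quadratic equation satisfied by `α_n`. -/
theorem alphaCoeff_quadratic (n : ℕ) :
    (2 * n + 5) * (alphaCoeff (n + 1) + (n + 2) * (n + 1) / ((2 * n + 7) * (2 * n + 5))) ^ 2
      = (n + 4) * (alphaCoeff (n + 1) ^ 2 + (n + 2) * (n + 6) * (n + 1) * (n + 5)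
        / ((2 * n + 9) * (2 * n + 7) ^ 2 * (2 * n + 5))) := by
  have hs : Real.sqrt (3 * (((n + 1 : ℕ) : ℝ) + 1) * ((n + 1 : ℕ) + 3)
      / ((2 * (n + 1 : ℕ) + 7) * (2 * (n + 1 : ℕ) + 3))) ^ 2
      = 3 * (n + 2) * (n + 4) / ((2 * n + 9) * (2 * n + 5)) := by
    rw [Real.sq_sqrt (by positivity)]
    push_cast
    ring
  rw [alphaCoeff]
  generalize Real.sqrt _ = r at hs
  push_cast
  -- Completing the square in the quadratic equation isolates `α + (n+2)/(2n+7)`, so only `r²`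
  -- enters below.
  have e : -((n : ℝ) + 1 + 1) / (2 * (n + 1) + 5) + (n + 1 + 3) / (2 * (n + 1) + 5) * r
      = (-(n + 2) + (n + 4) * r) / (2 * n + 7) := by
    field_simp; ring
  rw [e]
  have hs' : r ^ 2 * ((2 * n + 9) * (2 * n + 5)) = 3 * (n + 2) * (n + 4) := by
    rw [hs]; field_simp
  field_simp
  linear_combination ((n : ℝ) + 1) * (n + 4) ^ 2 * hs'

theorem inner_zFun_bump {n j : ℕ} (hj : j + 2 ≤ n + 1) :
    inner ℝ (zFun (n + 1)) (bump (j + 2)) = (0 : ℝ) := by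
  rw [zFun, inner_add_left, inner_smul_left, show n + 1 + 1 = n + 2 from rfl,
    show n + 1 + 3 = n + 2 + 2 from rfl, inner_bump_of_ne (by omega), inner_bump_of_ne (by omega)]
  simp

theorem inner_zFun_self (n : ℕ) : inner ℝ (zFun (n + 1)) (zFun (n + 1))
    = (alphaCoeff (n + 1) ^ 2 + (n + 2) * (n + 6) * (n + 1) * (n + 5)
        / ((2 * n + 9) * (2 * n + 7) ^ 2 * (2 * n + 5)))
        * (inner ℝ (bump (n + 2)) (bump (n + 2)) : ℝ) := by
  simp only [zFun, inner_add_left, inner_add_right, inner_smul_left, inner_smul_right,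
    show n + 1 + 1 = n + 2 from rfl, show n + 1 + 3 = n + 2 + 2 from rfl]
  rw [inner_bump_of_ne (by omega : n ≠ n + 2), inner_bump_of_ne (by omega : n + 2 ≠ n),
    show n + 2 + 2 = n + 1 + 3 from rfl, inner_bump_self, inner_bump_self]
  simp
  field_simp
  ring

theorem inner_zFun_ramp (n : ℕ) : inner ℝ (zFun (n + 1)) ramp
    = (alphaCoeff (n + 1) + (n + 2) * (n + 1) / ((2 * n + 7) * (2 * n + 5)))
        * (inner ℝ (bump (n + 2)) ramp : ℝ) := by
  rw [zFun, inner_add_left, inner_smul_left, show n + 1 + 3 = n + 4 from rfl,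
    inner_bump_ramp_add_two]
  simp
  ring

theorem inner_zFun_coramp (n : ℕ) : inner ℝ (zFun (n + 1)) coramp
    = (alphaCoeff (n + 1) + (n + 2) * (n + 1) / ((2 * n + 7) * (2 * n + 5)))
        * (inner ℝ (bump (n + 2)) coramp : ℝ) := by
  rw [zFun, inner_add_left, inner_smul_left, show n + 1 + 3 = n + 4 from rfl,
    inner_bump_coramp_add_two]
  simp
  ring

theorem inner_zFun_self_pos (n : ℕ) : (0 : ℝ) < inner ℝ (zFun (n + 1)) (zFun (n + 1)) := by
  have := inner_bump_self_pos n
  rw [inner_zFun_self]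
  positivity

theorem mem_innerSpan_orthogonal {n : ℕ} {f : Lp ℝ 2 (volume : Measure ℝ)}
    (hz : inner ℝ (zFun n) f = (0 : ℝ))
    (hb : ∀ j, j + 2 ≤ n → inner ℝ (bump (j + 2)) f = (0 : ℝ)) : f ∈ (innerSpan n)ᗮ := by
  rw [Submodule.mem_orthogonal]
  intro u hu
  induction hu using Submodule.span_induction with
  | mem u hu =>
    rcases hu with rfl | ⟨i, ⟨hi, hi'⟩, rfl⟩
    · exact hz
    · obtain ⟨j, rfl⟩ := Nat.exists_eq_add_of_le' hi
      exact hb j hi'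
  | zero => simp
  | add u v _ _ hu hv => rw [inner_add_left, hu, hv, add_zero]
  | smul c u _ hu => rw [inner_smul_left, hu, mul_zero]

theorem zFun_mem_innerSpan (n : ℕ) : zFun n ∈ innerSpan n :=
  Submodule.subset_span (Set.mem_insert _ _)

theorem bump_mem_innerSpan {n i : ℕ} (h : 2 ≤ i) (h' : i ≤ n) : bump i ∈ innerSpan n :=
  Submodule.subset_span (Set.mem_insert_of_mem _ ⟨i, ⟨h, h'⟩, rfl⟩)

/-- The generators are already orthogonal, so the projection is the usual Fourier sum. -/
theorem starProjection_innerSpan (n : ℕ) (f : Lp ℝ 2 (volume : Measure ℝ)) :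
    (innerSpan (n + 1)).starProjection f
      = (∑ j ∈ Finset.range n, ((inner ℝ (bump (j + 2)) f : ℝ)
          / inner ℝ (bump (j + 2)) (bump (j + 2))) • bump (j + 2))
        + ((inner ℝ (zFun (n + 1)) f : ℝ) / inner ℝ (zFun (n + 1)) (zFun (n + 1)))
          • zFun (n + 1) := by
  refine Submodule.eq_starProjection_of_mem_orthogonal ?_ (mem_innerSpan_orthogonal ?_ ?_)
  · refine add_mem (sum_mem fun j hj => Submodule.smul_mem _ _ ?_)
      (Submodule.smul_mem _ _ (zFun_mem_innerSpan _))
    exact bump_mem_innerSpan (by omega) (by have := Finset.mem_range.1 hj; omega)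
  · rw [inner_sub_right, inner_add_right, inner_sum, inner_smul_right,
      Finset.sum_eq_zero, zero_add, div_mul_cancel₀ _ (inner_zFun_self_pos n).ne', sub_self]
    intro j hj
    rw [inner_smul_right, inner_zFun_bump (by have := Finset.mem_range.1 hj; omega), mul_zero]
  · intro j hj
    rw [inner_sub_right, inner_add_right, inner_sum, inner_smul_right,
      Finset.sum_eq_single j, inner_smul_right,
      div_mul_cancel₀ _ (inner_bump_self_pos j).ne', real_inner_comm (zFun (n + 1)) (bump (j + 2)),
      inner_zFun_bump hj, mul_zero, add_zero, sub_self]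
    · intro i _ hi
      rw [inner_smul_right, inner_bump_of_ne hi.symm, mul_zero]
    · intro h
      exact absurd (Finset.mem_range.2 (by omega)) h

theorem inner_rFun_of_mem {n : ℕ} {g : Lp ℝ 2 (volume : Measure ℝ)} (hg : g ∈ innerSpan n) :
    inner ℝ (rFun n) g = (0 : ℝ) :=
  Submodule.starProjection_inner_eq_zero _ _ hg

theorem inner_lFun_of_mem {n : ℕ} {g : Lp ℝ 2 (volume : Measure ℝ)} (hg : g ∈ innerSpan n) :
    inner ℝ (lFun n) g = (0 : ℝ) :=
  Submodule.starProjection_inner_eq_zero _ _ hg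

/-- The pairing equals `⟨l,r⟩` minus the Fourier sum over the bumps minus the term of `z`. The first
two leave the telescoped remainder, and the quadratic equation for `α` makes the third cancel it. -/
theorem inner_lFun_rFun (n : ℕ) : inner ℝ (lFun (n + 1)) (rFun (n + 1)) = (0 : ℝ) := by
  have h := inner_bump_self_pos n
  have hz := inner_zFun_self_pos n
  rw [inner_zFun_self] at hz
  have hq := alphaCoeff_quadratic n
  have hsq := inner_bump_ramp_sq n
  rw [rFun, inner_sub_right, inner_lFun_of_mem (Submodule.starProjection_apply_mem _ _), sub_zero,
    lFun, inner_sub_left, starProjection_innerSpan, inner_add_left, sum_inner, inner_smul_left,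
    real_inner_comm, inner_ramp_coramp]
  simp only [inner_smul_left, RCLike.conj_to_real]
  have hsum := sum_inner_bump_ramp_coramp n
  simp_rw [div_mul_eq_mul_div, mul_comm (inner ℝ (bump _) coramp : ℝ)]
  rw [hsum, inner_zFun_self, inner_zFun_ramp, inner_zFun_coramp, inner_bump_coramp_eq]
  generalize alphaCoeff (n + 1) = α at *
  generalize (inner ℝ (bump (n + 2)) ramp : ℝ) = c at *
  generalize (inner ℝ (bump (n + 2)) (bump (n + 2)) : ℝ) = b at *
  generalize α ^ 2 + ((n : ℝ) + 2) * (n + 6) * (n + 1) * (n + 5)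
    / ((2 * n + 9) * (2 * n + 7) ^ 2 * (2 * n + 5)) = A at *
  have hA := pos_of_mul_pos_left hz h.le
  generalize α + ((n : ℝ) + 2) * (n + 1) / ((2 * n + 7) * (2 * n + 5)) = d at *
  -- The contribution of `z`, up to sign: the quadratic equation gives `d² / A`, the closed form of
  -- the squared pairings gives `c² / b`.
  have key : d ^ 2 * c ^ 2 / (A * b) = 1 / ((n + 1) * (n + 2) * (n + 3)) := by
    have hd : d ^ 2 = (n + 4) * A / (2 * n + 5) := by
      field_simp
      linarith
    rw [hd, hsq]
    field_simp
  have : d * ((-1) ^ n * c) / (A * b) * (d * c) = (-1) ^ n * (d ^ 2 * c ^ 2 / (A * b)) := by ring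
  rw [key] at this
  linear_combination -this

/-! ### The orthogonal polynomial family on the unit interval -/

/-- The polynomials behind `bump i`. -/
noncomputable def bumpPoly (i : ℕ) : ℝ[X] :=
  X * (1 - X) * (ultraspherical (5 / 2) (i - 2)).comp (2 * X - 1)

theorem unitPoly_bumpPoly (i : ℕ) : unitPoly (bumpPoly i) = bump i := rfl

theorem natDegree_bumpPoly_le {i : ℕ} (hi : 2 ≤ i) : (bumpPoly i).natDegree ≤ i := by
  have h1 : (X * (1 - X) : ℝ[X]).natDegree ≤ 2 := by compute_degree
  have h2 : ((ultraspherical (5 / 2) (i - 2)).comp (2 * X - 1)).natDegree ≤ i - 2 := by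
    refine natDegree_comp_le.trans ?_
    rw [(ultraspherical_monic_natDegree _ _).2]
    have : (2 * X - 1 : ℝ[X]).natDegree ≤ 1 := by compute_degree
    nlinarith
  exact natDegree_mul_le.trans (by omega)

theorem bumpPoly_eval_zero (i : ℕ) : (bumpPoly i).eval 0 = 0 := by simp [bumpPoly]

theorem bumpPoly_eval_one (i : ℕ) : (bumpPoly i).eval 1 = 0 := by simp [bumpPoly]

theorem exists_poly_of_mem_innerSpan {n : ℕ} {f : Lp ℝ 2 (volume : Measure ℝ)}
    (hf : f ∈ innerSpan n) :
    ∃ p : ℝ[X], unitPoly p = f ∧ p.natDegree ≤ n + 3 ∧ p.eval 0 = 0 ∧ p.eval 1 = 0 := by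
  induction hf using Submodule.span_induction with
  | mem u hu =>
    rcases hu with rfl | ⟨i, ⟨hi, hi'⟩, rfl⟩
    · refine ⟨alphaCoeff n • bumpPoly (n + 1) + bumpPoly (n + 3), ?_, ?_, ?_, ?_⟩
      · rw [unitPoly_add, unitPoly_smul]; rfl
      · have h2 := natDegree_bumpPoly_le (show 2 ≤ n + 3 by omega)
        refine natDegree_add_le_of_degree_le ((natDegree_smul_le _ _).trans ?_) h2
        rcases n with _ | n
        -- Truncated subtraction in the index makes the case `n = 0` harmless.
        · have : bumpPoly (0 + 1) = bumpPoly 2 := rfl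
          rw [this]
          exact (natDegree_bumpPoly_le le_rfl).trans (by omega)
        · exact (natDegree_bumpPoly_le (by omega)).trans (by omega)
      · simp [bumpPoly_eval_zero]
      · simp [bumpPoly_eval_one]
    · exact ⟨bumpPoly i, rfl, (natDegree_bumpPoly_le hi).trans (by omega), bumpPoly_eval_zero i,
        bumpPoly_eval_one i⟩
  | zero =>
    refine ⟨0, ?_, by simp, by simp, by simp⟩
    rw [← zero_smul ℝ (0 : ℝ[X]), unitPoly_smul, zero_smul]
  | add u v _ _ hu hv =>
    obtain ⟨p, rfl, hp, hp0, hp1⟩ := hu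
    obtain ⟨q, rfl, hq, hq0, hq1⟩ := hv
    exact ⟨p + q, unitPoly_add p q, natDegree_add_le_of_degree_le hp hq, by simp [hp0, hq0],
      by simp [hp1, hq1]⟩
  | smul c u _ hu =>
    obtain ⟨p, rfl, hp, hp0, hp1⟩ := hu
    exact ⟨c • p, unitPoly_smul c p, (natDegree_smul_le _ _).trans hp, by simp [hp0],
      by simp [hp1]⟩

/-- The polynomials whose restrictions to `[0, 1)` are `l^n` (index `0`), `r^n` (index `1`),
`φ̃^i` (index `i`, for `2 ≤ i ≤ n`) and `z^n` (index `n + 1`). -/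
structure IsUnitFamily (n : ℕ) (e : ℕ → ℝ[X]) : Prop where
  lFun : unitPoly (e 0) = lFun n
  rFun : unitPoly (e 1) = rFun n
  bump : ∀ i, 2 ≤ i → i ≤ n → unitPoly (e i) = bump i
  zFun : unitPoly (e (n + 1)) = zFun n
  natDegree_le : ∀ i, (e i).natDegree ≤ n + 3
  l_zero : (e 0).eval 0 = 1
  l_one : (e 0).eval 1 = 0
  r_zero : (e 1).eval 0 = 0
  r_one : (e 1).eval 1 = 1
  eval_zero : ∀ i, 2 ≤ i → (e i).eval 0 = 0
  eval_one : ∀ i, 2 ≤ i → (e i).eval 1 = 0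
  ne_zero : ∀ i, i ≤ n + 1 → e i ≠ 0
  orthogonal : ∀ i j, i ≤ n + 1 → j ≤ n + 1 → i ≠ j → ∫ t in (0 : ℝ)..1, (e i * e j).eval t = 0

theorem ne_zero_of_inner_unitPoly_pos {p : ℝ[X]}
    (h : (0 : ℝ) < inner ℝ (unitPoly p) (unitPoly p)) : p ≠ 0 := by
  rintro rfl
  rw [inner_unitPoly] at h
  simp at h

theorem exists_isUnitFamily {n : ℕ} (hn : 1 ≤ n) : ∃ e, IsUnitFamily n e := by
  obtain ⟨n, rfl⟩ := Nat.exists_eq_add_of_le' hn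
  obtain ⟨pl, hl, hld, hl0, hl1⟩ := exists_poly_of_mem_innerSpan
    (Submodule.starProjection_apply_mem (innerSpan (n + 1)) coramp)
  obtain ⟨pr, hr, hrd, hr0, hr1⟩ := exists_poly_of_mem_innerSpan
    (Submodule.starProjection_apply_mem (innerSpan (n + 1)) ramp)
  obtain ⟨pz, hz, hzd, hz0, hz1⟩ := exists_poly_of_mem_innerSpan (zFun_mem_innerSpan (n + 1))
  -- The level is now `n + 1`, so `z` has index `n + 2`. The value `0` beyond it lets the degree and
  -- endpoint conditions hold for all indices.
  obtain ⟨e, he0, he1, hez, heb, heo⟩ : ∃ e : ℕ → ℝ[X], e 0 = 1 - X - pl ∧ e 1 = X - pr ∧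
      e (n + 2) = pz ∧ (∀ i, 2 ≤ i → i ≤ n + 1 → e i = bumpPoly i) ∧ ∀ i, n + 2 < i → e i = 0 := by
    refine ⟨fun i => if i = 0 then 1 - X - pl else if i = 1 then X - pr else
      if i = n + 2 then pz else if i ≤ n + 1 then bumpPoly i else 0, by simp, by simp, by simp,
      fun i h h' => ?_, fun i h => ?_⟩
    · simp [show i ≠ 0 by omega, show i ≠ 1 by omega, show i ≠ n + 2 by omega, h']
    · simp [show i ≠ 0 by omega, show i ≠ 1 by omega, show i ≠ n + 2 by omega,
        show ¬ i ≤ n + 1 by omega]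
  have hL : unitPoly (e 0) = lFun (n + 1) := by
    rw [he0, unitPoly_sub, hl]; rfl
  have hR : unitPoly (e 1) = rFun (n + 1) := by
    rw [he1, unitPoly_sub, hr]; rfl
  have hB : ∀ i, 2 ≤ i → i ≤ n + 1 → unitPoly (e i) = bump i := fun i h h' => by
    rw [heb i h h', unitPoly_bumpPoly]
  have hZ : unitPoly (e (n + 1 + 1)) = zFun (n + 1) := by rw [← hz, ← hez]
  have hmem : ∀ i, 2 ≤ i → i ≤ n + 2 → unitPoly (e i) ∈ innerSpan (n + 1) := fun i h h' => by
    rcases h'.lt_or_eq with h' | rfl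
    · rw [hB i h (by omega)]; exact bump_mem_innerSpan h (by omega)
    · rw [hZ]; exact zFun_mem_innerSpan _
  have hcases : ∀ i, i = 0 ∨ i = 1 ∨ (2 ≤ i ∧ i ≤ n + 1) ∨ i = n + 2 ∨ n + 2 < i := by
    intro i; omega
  have horth : ∀ i j, i ≤ n + 2 → j ≤ n + 2 → i < j →
      (inner ℝ (unitPoly (e i)) (unitPoly (e j)) : ℝ) = 0 := by
    intro i j hi hj hij
    rcases hcases i with rfl | rfl | ⟨h2, h3⟩ | rfl | h
    · rcases hcases j with rfl | rfl | ⟨h2, h3⟩ | rfl | h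
      · omega
      · rw [hL, hR, inner_lFun_rFun]
      · rw [hL, inner_lFun_of_mem (hmem _ h2 hj)]
      · rw [hL, inner_lFun_of_mem (hmem _ (by omega) hj)]
      · omega
    · rw [hR, inner_rFun_of_mem (hmem _ (by omega) hj)]
    · obtain ⟨i, rfl⟩ := Nat.exists_eq_add_of_le' h2
      rcases hj.lt_or_eq with hj | rfl
      · obtain ⟨j, rfl⟩ := Nat.exists_eq_add_of_le' (show 2 ≤ j by omega)
        rw [hB _ h2 h3, hB _ (by omega) (by omega), inner_bump_of_ne (by omega)]
      · rw [hB _ h2 h3, real_inner_comm, hZ, inner_zFun_bump h3]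
    · omega
    · omega
  refine ⟨e, hL, hR, hB, hZ, ?_, ?_, ?_, ?_, ?_, ?_, ?_, ?_, ?_⟩
  · intro i
    rcases hcases i with rfl | rfl | ⟨h2, h3⟩ | rfl | h
    · rw [he0]
      refine natDegree_sub_le_of_le (m := n + 1 + 3) ?_ hld |>.trans (by simp)
      exact le_trans (b := 1) (by compute_degree) (by omega)
    · rw [he1]
      refine natDegree_sub_le_of_le (m := n + 1 + 3) ?_ hrd |>.trans (by simp)
      exact le_trans (b := 1) (by compute_degree) (by omega)
    · rw [heb i h2 h3]
      exact (natDegree_bumpPoly_le h2).trans (by omega)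
    · rw [hez]; exact hzd
    · rw [heo i h]; simp
  · simp [he0, hl0]
  · simp [he0, hl1]
  · simp [he1, hr0]
  · simp [he1, hr1]
  · intro i hi
    rcases hcases i with rfl | rfl | ⟨h2, h3⟩ | rfl | h
    · omega
    · omega
    · rw [heb i h2 h3, bumpPoly_eval_zero]
    · rw [hez, hz0]
    · rw [heo i h]; simp
  · intro i hi
    rcases hcases i with rfl | rfl | ⟨h2, h3⟩ | rfl | h
    · omega
    · omega
    · rw [heb i h2 h3, bumpPoly_eval_one]
    · rw [hez, hz1]
    · rw [heo i h]; simp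
  · intro i hi
    rcases hcases i with rfl | rfl | ⟨h2, h3⟩ | rfl | h
    · intro h; have := congrArg (eval 0) h; simp [he0, hl0] at this
    · intro h; have := congrArg (eval 1) h; simp [he1, hr1] at this
    · obtain ⟨i, rfl⟩ := Nat.exists_eq_add_of_le' h2
      refine ne_zero_of_inner_unitPoly_pos ?_
      rw [hB _ h2 h3]
      exact inner_bump_self_pos i
    · refine ne_zero_of_inner_unitPoly_pos ?_
      rw [hZ]
      exact inner_zFun_self_pos n
    · omega
  · intro i j hi hj hij
    rcases hij.lt_or_gt with h | h
    · rw [← inner_unitPoly, horth i j hi hj h]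
    · rw [mul_comm, ← inner_unitPoly, horth j i hj hi h]

/-- The top bump in `z^n` has index `n+3`; this is why the levels advance by three. -/
theorem innerSpan_le {n : ℕ} (hn : 1 ≤ n) : innerSpan n ≤ innerSpan (n + 3) := by
  refine Submodule.span_le.2 ?_
  rintro f (rfl | ⟨i, ⟨hi, hi'⟩, rfl⟩)
  · exact add_mem (Submodule.smul_mem _ _ (bump_mem_innerSpan (by omega) (by omega)))
      (bump_mem_innerSpan (by omega) (by omega))
  · exact bump_mem_innerSpan hi (hi'.trans (by omega))

/-! ### Cells of a knot sequence -/

/-- `x` and `y` are consecutive elements of `a`. -/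
structure IsCell (a : Set ℝ) (x y : ℝ) : Prop where
  left_mem : x ∈ a
  right_mem : y ∈ a
  lt : x < y
  le_of_lt : ∀ b ∈ a, x < b → y ≤ b

namespace IsCell

variable {a J : Set ℝ} {x y x' y' t : ℝ}

theorem le_of_lt_right (h : IsCell a x y) {b : ℝ} (hb : b ∈ a) (hby : b < y) : b ≤ x :=
  not_lt.1 fun hx => (h.le_of_lt b hb hx).not_gt hby

theorem knotSucc_eq (h : IsCell a x y) : knotSucc a x = y := by
  refine IsLeast.csInf_eq ⟨⟨y, ⟨h.right_mem, by exact_mod_cast h.lt⟩, rfl⟩, ?_⟩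
  rintro _ ⟨b, ⟨hb, hxb⟩, rfl⟩
  exact EReal.coe_le_coe_iff.2 (h.le_of_lt b hb (EReal.coe_lt_coe_iff.1 hxb))

theorem knotPred_eq (h : IsCell a x y) : knotPred a y = x := by
  refine IsGreatest.csSup_eq ⟨⟨x, ⟨h.left_mem, by exact_mod_cast h.lt⟩, rfl⟩, ?_⟩
  rintro _ ⟨b, ⟨hb, hxb⟩, rfl⟩
  exact EReal.coe_le_coe_iff.2 (h.le_of_lt_right hb (EReal.coe_lt_coe_iff.1 hxb))

theorem right_unique (h : IsCell a x y) (h' : IsCell a x y') : y = y' :=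
  le_antisymm (h.le_of_lt _ h'.right_mem h'.lt) (h'.le_of_lt _ h.right_mem h.lt)

theorem left_unique (h : IsCell a x y) (h' : IsCell a x' y) : x = x' :=
  le_antisymm (h'.le_of_lt_right h.left_mem h.lt) (h.le_of_lt_right h'.left_mem h'.lt)

theorem left_eq_of_mem (h : IsCell a x y) (h' : IsCell a x' y') (ht : t ∈ Set.Ico x y)
    (ht' : t ∈ Set.Ico x' y') : x = x' :=
  le_antisymm (h'.le_of_lt_right h.left_mem (ht.1.trans_lt ht'.2))
    (h.le_of_lt_right h'.left_mem (ht'.1.trans_lt ht.2))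

theorem Icc_subset (h : IsCell a x y) (hJ : J.OrdConnected) (ha : IsKnotSequence J a) :
    Set.Icc x y ⊆ J :=
  hJ.out (ha.subset h.left_mem) (ha.subset h.right_mem)

theorem Ico_subset (h : IsCell a x y) (hJ : J.OrdConnected) (ha : IsKnotSequence J a) :
    Set.Ico x y ⊆ J :=
  Set.Ico_subset_Icc_self.trans (h.Icc_subset hJ ha)

theorem left_lt_sSup (h : IsCell a x y) (ha : IsKnotSequence J a) :
    (x : EReal) < sSup ((fun t : ℝ => (t : EReal)) '' J) :=
  (EReal.coe_lt_coe_iff.2 h.lt).trans_le (le_sSup ⟨y, ha.subset h.right_mem, rfl⟩)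

theorem sInf_lt_right (h : IsCell a x y) (ha : IsKnotSequence J a) :
    sInf ((fun t : ℝ => (t : EReal)) '' J) < (y : EReal) :=
  (sInf_le ⟨x, ha.subset h.left_mem, rfl⟩ : sInf ((fun t : ℝ => (t : EReal)) '' J) ≤ x).trans_lt
    (EReal.coe_lt_coe_iff.2 h.lt)

end IsCell

namespace IsKnotSequence

variable {J a : Set ℝ}

theorem finite_inter_Icc (ha : IsKnotSequence J a) {c d : ℝ} (h : Set.Icc c d ⊆ J) :
    (a ∩ Set.Icc c d).Finite := by
  by_contra hinf
  obtain ⟨x, hx, hacc⟩ := Set.Infinite.exists_accPt_of_subset_isCompact hinf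
    (isCompact_Icc (a := c) (b := d)) Set.inter_subset_right
  exact ha.no_cluster x (h hx) (hacc.mono (Filter.principal_mono.2 Set.inter_subset_left))

theorem exists_gt (ha : IsKnotSequence J a) {t : ℝ}
    (h : (t : EReal) < sSup ((fun t : ℝ => (t : EReal)) '' J)) : ∃ b ∈ a, t < b := by
  rw [← ha.sup_eq, lt_sSup_iff] at h
  obtain ⟨_, ⟨b, hb, rfl⟩, hlt⟩ := h
  exact ⟨b, hb, EReal.coe_lt_coe_iff.1 hlt⟩

theorem exists_lt (ha : IsKnotSequence J a) {t : ℝ}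
    (h : sInf ((fun t : ℝ => (t : EReal)) '' J) < (t : EReal)) : ∃ b ∈ a, b < t := by
  rw [← ha.inf_eq, sInf_lt_iff] at h
  obtain ⟨_, ⟨b, hb, rfl⟩, hlt⟩ := h
  exact ⟨b, hb, EReal.coe_lt_coe_iff.1 hlt⟩

/-- Only finitely many knots lie in `[b, c]`, so there is a last one up to `t` and a first one
beyond it. -/
theorem exists_isCell_of_le_of_lt (hJ : J.OrdConnected) (ha : IsKnotSequence J a) {b t c : ℝ}
    (hb : b ∈ a) (hc : c ∈ a) (hbt : b ≤ t) (htc : t < c) :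
    ∃ x y, IsCell a x y ∧ t ∈ Set.Ico x y := by
  have hfin := ha.finite_inter_Icc (hJ.out (ha.subset hb) (ha.subset hc))
  obtain ⟨x, ⟨hxa, hxt⟩, hx⟩ := (hfin.subset (t := {s | s ∈ a ∧ b ≤ s ∧ s ≤ t})
    (fun s hs => ⟨hs.1, hs.2.1, hs.2.2.trans htc.le⟩)).exists_maximal ⟨b, hb, le_rfl, hbt⟩
  obtain ⟨y, ⟨hya, hyt⟩, hy⟩ := (hfin.subset (t := {s | s ∈ a ∧ t < s ∧ s ≤ c})
    (fun s hs => ⟨hs.1, hbt.trans hs.2.1.le, hs.2.2⟩)).exists_minimal ⟨c, hc, htc, le_rfl⟩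
  refine ⟨x, y, ⟨hxa, hya, hxt.2.trans_lt hyt.1, fun s hs hxs => ?_⟩, hxt.2, hyt.1⟩
  by_contra! hsy
  have hts : t < s := by
    by_contra! hst
    exact (hx ⟨hs, hxt.1.trans hxs.le, hst⟩ hxs.le).not_gt hxs
  exact (hy ⟨hs, hts, hsy.le.trans hyt.2⟩ hsy.le).not_gt hsy

theorem exists_isCell_right (hJ : J.OrdConnected) (ha : IsKnotSequence J a) {x : ℝ} (hx : x ∈ a)
    (h : (x : EReal) < sSup ((fun t : ℝ => (t : EReal)) '' J)) : ∃ y, IsCell a x y := by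
  obtain ⟨c, hc, hxc⟩ := ha.exists_gt h
  obtain ⟨x', y, hcell, hmem⟩ := ha.exists_isCell_of_le_of_lt hJ hx hc le_rfl hxc
  have : x = x' := le_antisymm (hcell.le_of_lt_right hx hmem.2) hmem.1
  exact ⟨y, this ▸ hcell⟩

theorem exists_isCell_left (hJ : J.OrdConnected) (ha : IsKnotSequence J a) {y : ℝ} (hy : y ∈ a)
    (h : sInf ((fun t : ℝ => (t : EReal)) '' J) < (y : EReal)) : ∃ x, IsCell a x y := by
  obtain ⟨b, hb, hby⟩ := ha.exists_lt h
  have hfin := ha.finite_inter_Icc (hJ.out (ha.subset hb) (ha.subset hy))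
  obtain ⟨x, ⟨hxa, hxt⟩, hx⟩ := (hfin.subset (t := {s | s ∈ a ∧ b ≤ s ∧ s < y})
    (fun s hs => ⟨hs.1, hs.2.1, hs.2.2.le⟩)).exists_maximal ⟨b, hb, le_rfl, hby⟩
  refine ⟨x, hxa, hy, hxt.2, fun s hs hxs => ?_⟩
  by_contra! hsy
  exact (hx ⟨hs, hxt.1.trans hxs.le, hsy⟩ hxs.le).not_gt hxs

theorem exists_isCell_mem (hJ : J.OrdConnected) (ha : IsKnotSequence J a) {t : ℝ}
    (h : sInf ((fun t : ℝ => (t : EReal)) '' J) < (t : EReal))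
    (h' : (t : EReal) < sSup ((fun t : ℝ => (t : EReal)) '' J)) :
    ∃ x y, IsCell a x y ∧ t ∈ Set.Ico x y := by
  obtain ⟨b, hb, hbt⟩ := ha.exists_lt h
  obtain ⟨c, hc, htc⟩ := ha.exists_gt h'
  exact ha.exists_isCell_of_le_of_lt hJ hb hc hbt.le htc

theorem knotSucc_eq_top (ha : IsKnotSequence J a) {x : ℝ}
    (h : ¬ (x : EReal) < sSup ((fun t : ℝ => (t : EReal)) '' J)) : knotSucc a x = ⊤ := by
  have : {b | b ∈ a ∧ (x : EReal) < (b : EReal)} = ∅ := by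
    refine Set.eq_empty_of_forall_notMem fun b hb => h (hb.2.trans_le ?_)
    exact le_sSup ⟨b, ha.subset hb.1, rfl⟩
  rw [knotSucc, this, Set.image_empty, sInf_empty]

theorem knotPred_eq_bot (ha : IsKnotSequence J a) {x : ℝ}
    (h : ¬ sInf ((fun t : ℝ => (t : EReal)) '' J) < (x : EReal)) : knotPred a x = ⊥ := by
  have : {b | b ∈ a ∧ (b : EReal) < (x : EReal)} = ∅ := by
    refine Set.eq_empty_of_forall_notMem fun b hb => h (lt_of_le_of_lt ?_ hb.2)
    exact sInf_le ⟨b, ha.subset hb.1, rfl⟩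
  rw [knotPred, this, Set.image_empty, sSup_empty]

/-- The interiors of the cells are disjoint nonempty open subsets of the line. -/
theorem countable_isCell (a : Set ℝ) : {p : ℝ × ℝ | IsCell a p.1 p.2}.Countable := by
  refine Set.PairwiseDisjoint.countable_of_isOpen (s := fun p : ℝ × ℝ => Set.Ioo p.1 p.2)
    ?_ (fun p _ => isOpen_Ioo) (fun p hp => Set.nonempty_Ioo.2 hp.lt)
  intro p hp q hq hne
  rw [Function.onFun, Set.disjoint_left]
  intro t ht ht'
  have h : p.1 = q.1 := hp.left_eq_of_mem hq (Set.Ioo_subset_Ico_self ht)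
    (Set.Ioo_subset_Ico_self ht')
  exact hne (Prod.ext h (hp.right_unique (h ▸ hq)))

/-- The countably many cells cover `J` except possibly its two ends. This reduces almost everywhere
statements on `J` to single cells. -/
theorem ae_of_isCell (hJ : J.OrdConnected) (ha : IsKnotSequence J a) {P : ℝ → Prop}
    (h : ∀ x y, IsCell a x y → ∀ᵐ t ∂(volume.restrict (Set.Ico x y)), P t) :
    ∀ᵐ t ∂(volume.restrict J), P t := by
  rw [ae_restrict_iff' hJ.measurableSet]
  have hc : ∀ᵐ t : ℝ, ∀ p ∈ {p : ℝ × ℝ | IsCell a p.1 p.2}, t ∈ Set.Ico p.1 p.2 → P t := by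
    rw [ae_ball_iff (countable_isCell a)]
    intro p hp
    exact (ae_restrict_iff' measurableSet_Ico).1 (h _ _ hp)
  have hend : ∀ u : EReal, ∀ᵐ t : ℝ, (t : EReal) ≠ u := by
    intro u
    rw [ae_iff]
    refine Set.Subsingleton.measure_zero (fun s hs t ht => ?_) _
    simp only [ne_eq, not_not, Set.mem_ofPred_eq] at hs ht
    exact EReal.coe_injective (hs.trans ht.symm)
  filter_upwards [hc, hend (sInf ((fun t : ℝ => (t : EReal)) '' J)),
    hend (sSup ((fun t : ℝ => (t : EReal)) '' J))] with t h1 h2 h3 ht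
  obtain ⟨x, y, hcell, hmem⟩ := ha.exists_isCell_mem hJ
    (lt_of_le_of_ne (sInf_le ⟨t, ht, rfl⟩) h2.symm) (lt_of_le_of_ne (le_sSup ⟨t, ht, rfl⟩) h3)
  exact h1 (x, y) hcell hmem

end IsKnotSequence

/-! ### Transport of functions to a cell -/

section

variable {J a : Set ℝ} {x y : ℝ}

/-- Needed to pull almost everywhere identities on the line back through the affine map of a cell.
-/
theorem quasiMeasurePreserving_sub_div {x y : ℝ} (h : x < y) :
    Measure.QuasiMeasurePreserving (fun t : ℝ => (t - x) / (y - x)) volume volume := by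
  have hc : (y - x)⁻¹ ≠ 0 := inv_ne_zero (sub_pos.2 h).ne'
  have h1 : Measure.QuasiMeasurePreserving (fun t : ℝ => t * (y - x)⁻¹) volume volume := by
    refine ⟨by fun_prop, ?_⟩
    rw [Real.map_volume_mul_right hc]
    exact Measure.AbsolutelyContinuous.rfl.smul_left _
  have := h1.comp (measurePreserving_add_right volume (-x)).quasiMeasurePreserving
  convert this using 2 with t
  simp [div_eq_mul_inv, sub_eq_add_neg]

theorem coeFn_onKnot (h : IsCell a x y) (f : Lp ℝ 2 (volume : Measure ℝ)) :
    onKnot J a f x =ᵐ[volume.restrict J] fun t => f ((t - x) / (y - x)) := by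
  rw [onKnot, h.knotSucc_eq, EReal.toReal_coe, placeOn, dif_pos h.lt]
  exact MemLp.coeFn_toLp _

theorem onKnot_add (h : IsCell a x y) (f g : Lp ℝ 2 (volume : Measure ℝ)) :
    onKnot J a (f + g) x = onKnot J a f x + onKnot J a g x := by
  apply Lp.ext
  filter_upwards [coeFn_onKnot (J := J) h f, coeFn_onKnot (J := J) h g,
    coeFn_onKnot (J := J) h (f + g), Lp.coeFn_add (onKnot J a f x) (onKnot J a g x),
    ae_restrict_of_ae ((quasiMeasurePreserving_sub_div h.lt).ae (Lp.coeFn_add f g))]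
    with t h1 h2 h3 h4 h5
  rw [h3, h4, h5, Pi.add_apply, Pi.add_apply, h1, h2]

theorem onKnot_smul (h : IsCell a x y) (c : ℝ) (f : Lp ℝ 2 (volume : Measure ℝ)) :
    onKnot J a (c • f) x = c • onKnot J a f x := by
  apply Lp.ext
  filter_upwards [coeFn_onKnot (J := J) h f, coeFn_onKnot (J := J) h (c • f),
    Lp.coeFn_smul c (onKnot J a f x),
    ae_restrict_of_ae ((quasiMeasurePreserving_sub_div h.lt).ae (Lp.coeFn_smul c f))]
    with t h1 h3 h4 h5
  rw [h3, h4, h5, Pi.smul_apply, Pi.smul_apply, h1]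

theorem onKnot_zero (h : IsCell a x y) : onKnot J a 0 x = 0 := by
  simpa using onKnot_smul (J := J) h 0 0

theorem onKnot_unitPoly (h : IsCell a x y) (p : ℝ[X]) :
    onKnot J a (unitPoly p) x =ᵐ[volume.restrict J]
      (Set.Ico x y).indicator fun t => p.eval ((t - x) / (y - x)) := by
  filter_upwards [coeFn_onKnot (J := J) h (unitPoly p),
    ae_restrict_of_ae ((quasiMeasurePreserving_sub_div h.lt).ae (coeFn_unitPoly p))] with t h1 h2
  have hd : 0 < y - x := sub_pos.2 h.lt
  rw [h1, h2]
  by_cases ht : t ∈ Set.Ico x y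
  · rw [Set.indicator_of_mem ht, Set.indicator_of_mem]
    exact ⟨div_nonneg (sub_nonneg.2 ht.1) hd.le, (div_lt_one hd).2 (by linarith [ht.2])⟩
  · rw [Set.indicator_of_notMem ht, Set.indicator_of_notMem]
    rintro ⟨h3, h4⟩
    refine ht ⟨?_, ?_⟩
    · rw [le_div_iff₀ hd] at h3; linarith
    · rw [div_lt_one hd] at h4; linarith

/-- `onKnot` of a piece agrees on every cell either with that piece or with `0`. -/
theorem onKnot_unitPoly_ae_isCell (hJ : J.OrdConnected) (ha : IsKnotSequence J a)
    (h : IsCell a x y) (p : ℝ[X]) {x' y' : ℝ} (h' : IsCell a x' y') :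
    ∀ᵐ t ∂(volume.restrict (Set.Ico x' y')), onKnot J a (unitPoly p) x t
      = if x' = x then p.eval ((t - x') / (y' - x')) else 0 := by
  have h1 := ae_mono (Measure.restrict_mono (h'.Ico_subset hJ ha) le_rfl)
    (onKnot_unitPoly (J := J) h p)
  filter_upwards [h1, ae_restrict_mem measurableSet_Ico] with t ht hm
  rw [ht]
  split_ifs with hx
  · subst hx
    rw [h.right_unique h', Set.indicator_of_mem hm]
  · exact Set.indicator_of_notMem (fun hm' => hx (h'.left_eq_of_mem h hm hm')) _

/-! ### Combinatorial description of the basis by indices and labels -/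

/-- Indices for the members of `Ω^n`: the functions placed on a single cell with left end `x`,
and the functions centered on the knot `v`. -/
inductive OmegaIndex where
  | inner (x : ℝ) (i : ℕ)
  | hat (v : ℝ)

namespace OmegaIndex

open scoped Classical in
/-- The label, on the cell `[x, y]`, of the function with the given index. -/
noncomputable def label (x y : ℝ) : OmegaIndex → Option ℕ
  | inner x' i => if x = x' then some i else none
  | hat v => if x = v then some 0 else if y = v then some 1 else none

/-- The indices which occur in `Ω^n`. -/
def Valid (a : Set ℝ) (n : ℕ) : OmegaIndex → Prop
  | inner x i => (∃ y, IsCell a x y) ∧ 2 ≤ i ∧ i ≤ n + 1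
  | hat v => v ∈ a

/-- The polynomial of a label. -/
noncomputable def labelPoly (e : ℕ → ℝ[X]) (o : Option ℕ) : ℝ[X] := o.elim 0 e

theorem Valid.label_le {n : ℕ} (hn : 1 ≤ n) {k : OmegaIndex} (h : k.Valid a n) {i : ℕ}
    (hi : k.label x y = some i) : i ≤ n + 1 := by
  cases k with
  | inner x' j =>
    simp only [label] at hi
    split_ifs at hi
    cases hi
    exact h.2.2
  | hat v =>
    simp only [label] at hi
    split_ifs at hi <;> cases hi <;> omega

/-- Labels `0` and `1` come only from the hats at the left and right end of the cell, and labels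
from `2` on only from inner functions. This injectivity carries both orthogonality and local
finiteness. -/
theorem Valid.eq_of_label {n : ℕ} {k k' : OmegaIndex} (h : k.Valid a n) (h' : k'.Valid a n)
    {i : ℕ} (hi : k.label x y = some i) (hi' : k'.label x y = some i) : k = k' := by
  cases k with
  | inner x₁ j =>
    have hj := h.2.1
    simp only [label] at hi
    split_ifs at hi with h1
    cases hi
    cases k' with
    | inner x₂ j' =>
      simp only [label] at hi'
      split_ifs at hi' with h2
      cases hi'
      rw [← h1, ← h2]
    | hat v =>
      simp only [label] at hi'
      split_ifs at hi' <;> cases hi' <;> omega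
  | hat v =>
    simp only [label] at hi
    cases k' with
    | inner x₂ j' =>
      have hj := h'.2.1
      simp only [label] at hi'
      split_ifs at hi' with h2
      cases hi'
      split_ifs at hi <;> cases hi <;> omega
    | hat v' =>
      simp only [label] at hi'
      split_ifs at hi hi' <;> cases hi <;> first | omega | simp_all

theorem Valid.exists_label_ne_none (hJ : J.OrdConnected) (ha : IsKnotSequence J a) {n : ℕ}
    {k : OmegaIndex} (h : k.Valid a n) : ∃ x y, IsCell a x y ∧ k.label x y ≠ none := by
  cases k with
  | inner x i =>
    obtain ⟨y, hy⟩ := h.1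
    exact ⟨x, y, hy, by simp [label]⟩
  | hat v =>
    by_cases hv : (v : EReal) < sSup ((fun t : ℝ => (t : EReal)) '' J)
    · obtain ⟨y, hy⟩ := ha.exists_isCell_right hJ h hv
      exact ⟨v, y, hy, by simp [label]⟩
    -- A knot at both ends of `J` would be the only one.
    · have hv' : sInf ((fun t : ℝ => (t : EReal)) '' J) < v := by
        by_contra hlt
        have hsub : a ⊆ {v} := by
          intro w hw
          have h1 := (not_lt.1 hlt).trans (sInf_le ⟨w, ha.subset hw, rfl⟩)
          have h2 := (le_sSup ⟨w, ha.subset hw, rfl⟩ : (w : EReal) ≤ sSup ((fun t : ℝ =>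
            (t : EReal)) '' J)).trans (not_lt.1 hv)
          exact le_antisymm (EReal.coe_le_coe_iff.1 h2) (EReal.coe_le_coe_iff.1 h1)
        have := ha.three_le.trans (Set.encard_le_encard hsub)
        rw [Set.encard_singleton] at this
        exact absurd this (by norm_num)
      obtain ⟨x, hx⟩ := ha.exists_isCell_left hJ h hv'
      refine ⟨x, v, hx, ?_⟩
      by_cases hxv : x = v <;> simp [label, hxv]

end OmegaIndex

open OmegaIndex

/-- `f` is represented by the index `k`: it agrees on every cell with the piece given by the
label of `k` on that cell. -/
def Represents (J a : Set ℝ) (e : ℕ → ℝ[X]) (k : OmegaIndex) (f : L2On J) : Prop :=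
  ∀ x y, IsCell a x y → ∀ᵐ t ∂(volume.restrict (Set.Ico x y)),
    f t = (labelPoly e (k.label x y)).eval ((t - x) / (y - x))

theorem represents_inner (hJ : J.OrdConnected) (ha : IsKnotSequence J a) (e : ℕ → ℝ[X])
    (h : IsCell a x y) (i : ℕ) :
    Represents J a e (inner x i) (onKnot J a (unitPoly (e i)) x) := by
  intro x' y' h'
  filter_upwards [onKnot_unitPoly_ae_isCell hJ ha h (e i) h'] with t ht
  rw [ht, label]
  split_ifs <;> simp [labelPoly]

theorem represents_hat (hJ : J.OrdConnected) (ha : IsKnotSequence J a) (e : ℕ → ℝ[X])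
    {w v u : ℝ} (h : IsCell a w v) (h' : IsCell a v u) :
    Represents J a e (hat v)
      (onKnot J a (unitPoly (e 1)) w + onKnot J a (unitPoly (e 0)) v) := by
  intro x y hc
  filter_upwards [onKnot_unitPoly_ae_isCell hJ ha h (e 1) hc,
    onKnot_unitPoly_ae_isCell hJ ha h' (e 0) hc,
    ae_mono (Measure.restrict_mono (hc.Ico_subset hJ ha) le_rfl)
      (Lp.coeFn_add (onKnot J a (unitPoly (e 1)) w) (onKnot J a (unitPoly (e 0)) v))]
    with t h1 h2 h3
  rw [h3, Pi.add_apply, h1, h2, label]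
  by_cases hv : x = v
  · have : x ≠ w := by rw [hv]; exact h.lt.ne'
    simp [hv, labelPoly, h.lt.ne']
  · by_cases hy : y = v
    · have : x = w := by subst hy; exact hc.left_unique h
      simp [hy, this, labelPoly, h.lt.ne]
    · have : x ≠ w := by rintro rfl; exact hy (hc.right_unique h)
      simp [hv, hy, this, labelPoly]

theorem represents_hat_left (hJ : J.OrdConnected) (ha : IsKnotSequence J a) (e : ℕ → ℝ[X])
    (h : IsCell a x y) (hx : (x : EReal) = sInf ((fun t : ℝ => (t : EReal)) '' J)) :
    Represents J a e (hat x) (onKnot J a (unitPoly (e 0)) x) := by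
  intro x' y' hc
  filter_upwards [onKnot_unitPoly_ae_isCell hJ ha h (e 0) hc] with t ht
  have : y' ≠ x := by rintro rfl; exact (hc.sInf_lt_right ha).ne' hx
  rw [ht, label, if_neg this]
  split_ifs <;> simp [labelPoly]

theorem represents_hat_right (hJ : J.OrdConnected) (ha : IsKnotSequence J a) (e : ℕ → ℝ[X])
    (h : IsCell a x y) (hy : (y : EReal) = sSup ((fun t : ℝ => (t : EReal)) '' J)) :
    Represents J a e (hat y) (onKnot J a (unitPoly (e 1)) x) := by
  intro x' y' hc
  filter_upwards [onKnot_unitPoly_ae_isCell hJ ha h (e 1) hc] with t ht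
  have hne : x' ≠ y := by rintro rfl; exact (hc.left_lt_sSup ha).ne hy
  have hiff : y' = y ↔ x' = x :=
    ⟨by rintro rfl; exact hc.left_unique h, by rintro rfl; exact hc.right_unique h⟩
  rw [ht, label, if_neg hne]
  simp only [hiff]
  split_ifs <;> simp [labelPoly]

theorem exists_represents (hJ : J.OrdConnected) (ha : IsKnotSequence J a) {n : ℕ} (hn : 1 ≤ n)
    {e : ℕ → ℝ[X]} (he : IsUnitFamily n e) {f : L2On J} (hf : f ∈ omegaBasis J a n) :
    ∃ k : OmegaIndex, k.Valid a n ∧ Represents J a e k f := by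
  obtain ⟨x, hxa, hx, h⟩ := hf
  obtain ⟨y, hc⟩ := ha.exists_isCell_right hJ hxa hx
  rcases h with (rfl | ⟨i, hi, hi', rfl⟩ | ⟨hinf, rfl⟩ | ⟨hsup, rfl⟩) | ⟨hinf, rfl⟩
  · rw [← he.zFun]
    exact ⟨inner x (n + 1), ⟨⟨y, hc⟩, by omega, le_rfl⟩, represents_inner hJ ha e hc _⟩
  · rw [← he.bump i hi hi']
    exact ⟨inner x i, ⟨⟨y, hc⟩, hi, by omega⟩, represents_inner hJ ha e hc _⟩
  · rw [← he.lFun]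
    exact ⟨hat x, hxa, represents_hat_left hJ ha e hc hinf⟩
  · rw [← he.rFun]
    rw [hc.knotSucc_eq] at hsup
    exact ⟨hat y, hc.right_mem, represents_hat_right hJ ha e hc hsup⟩
  · obtain ⟨w, hw⟩ := ha.exists_isCell_left hJ hxa hinf
    rw [omegaBar, ← he.rFun, ← he.lFun, hw.knotPred_eq, EReal.toReal_coe]
    exact ⟨hat x, hxa, represents_hat hJ ha e hw hc⟩

/-- Used mostly in contrapositive form: distinct members have distinct indices. -/
theorem Represents.unique (hJ : J.OrdConnected) (ha : IsKnotSequence J a) {e : ℕ → ℝ[X]}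
    {k : OmegaIndex} {f g : L2On J} (hf : Represents J a e k f) (hg : Represents J a e k g) :
    f = g := by
  apply Lp.ext
  refine ha.ae_of_isCell hJ fun x y h => ?_
  filter_upwards [hf x y h, hg x y h] with t h1 h2
  rw [h1, h2]

theorem eval_comp_not_ae_zero (h : x < y) {p : ℝ[X]} (hp : p ≠ 0) :
    ¬ ∀ᵐ t ∂(volume.restrict (Set.Ico x y)), p.eval ((t - x) / (y - x)) = 0 := by
  intro hae
  have hd : y - x ≠ 0 := (sub_pos.2 h).ne'
  have hfin : {t | p.eval ((t - x) / (y - x)) = 0}.Finite := by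
    refine Set.Finite.of_injOn (t := {s | p.IsRoot s}) (f := fun t => (t - x) / (y - x))
      (fun t ht => ht) ?_ (p.finite_setOfPred_isRoot hp)
    intro s _ t _ hst
    simpa [div_left_inj' hd] using hst
  have h0 : volume (Set.Ico x y) = 0 := by
    have h1 := (ae_restrict_iff' measurableSet_Ico).1 hae
    refine measure_mono_null (t := {t | ¬ (t ∈ Set.Ico x y → p.eval ((t - x) / (y - x)) = 0)}
      ∪ {t | p.eval ((t - x) / (y - x)) = 0}) (fun t ht => ?_)
      (measure_union_null h1 (hfin.measure_zero _))
    by_cases h2 : p.eval ((t - x) / (y - x)) = 0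
    · exact Or.inr h2
    · exact Or.inl fun h3 => h2 (h3 ht)
  rw [Real.volume_Ico, ENNReal.ofReal_eq_zero] at h0
  linarith

/-- A nonzero polynomial has finitely many roots, so it cannot vanish almost everywhere on a cell.
Support conditions can thus be read off from labels. -/
theorem Represents.label_eq_none_iff {n : ℕ} (hn : 1 ≤ n) {e : ℕ → ℝ[X]} (he : IsUnitFamily n e)
    {k : OmegaIndex} (hk : k.Valid a n) {f : L2On J} (hf : Represents J a e k f)
    (h : IsCell a x y) :
    k.label x y = none ↔ ∀ᵐ t ∂(volume.restrict (Set.Ico x y)), f t = 0 := by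
  constructor
  · intro h0
    filter_upwards [hf x y h] with t ht
    rw [ht, h0]
    simp [labelPoly]
  · intro h0
    by_contra hne
    obtain ⟨i, hi⟩ := Option.ne_none_iff_exists'.1 hne
    refine eval_comp_not_ae_zero h.lt (he.ne_zero i (hk.label_le hn hi)) ?_
    filter_upwards [hf x y h, h0] with t h1 h2
    rw [← h2, h1, hi]
    rfl

/-! ### Orthogonality, cell by cell and globally -/

theorem setIntegral_eval_comp (h : x < y) (p : ℝ[X]) :
    ∫ t in Set.Ico x y, p.eval ((t - x) / (y - x)) = (y - x) * ∫ t in (0 : ℝ)..1, p.eval t := by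
  have hd : y - x ≠ 0 := (sub_pos.2 h).ne'
  rw [integral_Ico_eq_integral_Ioo, ← integral_Ioc_eq_integral_Ioo,
    ← intervalIntegral.integral_of_le h.le]
  simp_rw [sub_div]
  rw [intervalIntegral.integral_comp_div_sub (fun s => p.eval s) hd, smul_eq_mul, ← sub_div,
    ← sub_div, sub_self, zero_div, div_self hd]

/-- On one cell the two members are either zero or rescaled polynomials with different labels, and
those are orthogonal on `[0,1]`. -/
theorem setIntegral_mul_eq_zero (hJ : J.OrdConnected) (ha : IsKnotSequence J a) {n : ℕ}
    (hn : 1 ≤ n) {f g : L2On J} (hf : f ∈ omegaBasis J a n) (hg : g ∈ omegaBasis J a n)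
    (hfg : f ≠ g) (h : IsCell a x y) : ∫ t in Set.Ico x y, f t * g t = 0 := by
  obtain ⟨e, he⟩ := exists_isUnitFamily hn
  obtain ⟨k, hk, hkf⟩ := exists_represents hJ ha hn he hf
  obtain ⟨l, hl, hlg⟩ := exists_represents hJ ha hn he hg
  have hkl : k ≠ l := by
    rintro rfl
    exact hfg (hkf.unique hJ ha hlg)
  have h1 : ∫ t in Set.Ico x y, f t * g t = ∫ t in Set.Ico x y,
      (labelPoly e (k.label x y) * labelPoly e (l.label x y)).eval ((t - x) / (y - x)) := by
    refine integral_congr_ae ?_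
    filter_upwards [hkf x y h, hlg x y h] with t h1 h2
    rw [h1, h2, eval_mul]
  rw [h1, setIntegral_eval_comp h.lt]
  rcases hi : k.label x y with _ | i
  · simp [labelPoly]
  rcases hj : l.label x y with _ | j
  · simp [labelPoly]
  have hij : i ≠ j := by
    rintro rfl
    exact hkl (hk.eq_of_label hl hi hj)
  rw [labelPoly, labelPoly, Option.elim_some, Option.elim_some,
    he.orthogonal i j (hk.label_le hn hi) (hl.label_le hn hj) hij, mul_zero]

theorem inner_omegaBasis_eq_zero (hJ : J.OrdConnected) (ha : IsKnotSequence J a) {n : ℕ}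
    (hn : 1 ≤ n) {f g : L2On J} (hf : f ∈ omegaBasis J a n) (hg : g ∈ omegaBasis J a n)
    (hfg : f ≠ g) : inner ℝ f g = (0 : ℝ) := by
  have hcount : Countable {p : ℝ × ℝ | IsCell a p.1 p.2} :=
    (IsKnotSequence.countable_isCell a).to_subtype
  have hsub : (⋃ p : {p : ℝ × ℝ | IsCell a p.1 p.2}, Set.Ico p.1.1 p.1.2) ⊆ J :=
    Set.iUnion_subset fun p => IsCell.Ico_subset p.2 hJ ha
  have hmeas : MeasurableSet (⋃ p : {p : ℝ × ℝ | IsCell a p.1 p.2}, Set.Ico p.1.1 p.1.2) :=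
    MeasurableSet.iUnion fun p => measurableSet_Ico
  have hJeq : ∫ t in J, f t * g t
      = ∫ t in ⋃ p : {p : ℝ × ℝ | IsCell a p.1 p.2}, Set.Ico p.1.1 p.1.2, f t * g t := by
    refine setIntegral_congr_set (Filter.EventuallyLE.antisymm ?_ hsub.eventuallyLE)
    refine (ae_restrict_iff' hJ.measurableSet).1 (ha.ae_of_isCell hJ fun x y h => ?_)
    filter_upwards [ae_restrict_mem measurableSet_Ico] with t ht
    exact Set.mem_iUnion.2 ⟨⟨(x, y), h⟩, ht⟩
  have hint : Integrable (fun t => f t * g t) (volume.restrict J) :=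
    (Lp.memLp f).integrable_mul (Lp.memLp g)
  have hsum := hasSum_integral_iUnion (f := fun t => f t * g t) (μ := volume)
    (s := fun p : {p : ℝ × ℝ | IsCell a p.1 p.2} => Set.Ico p.1.1 p.1.2)
    (fun p => measurableSet_Ico) (fun p q hpq => ?_) (hint.mono_measure
      (Measure.restrict_mono hsub le_rfl))
  · simp_rw [fun p : {p : ℝ × ℝ | IsCell a p.1 p.2} =>
      setIntegral_mul_eq_zero hJ ha hn hf hg hfg p.2] at hsum
    rw [L2.inner_def]
    simp only [RCLike.inner_apply, RCLike.conj_to_real]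
    simp_rw [fun t => mul_comm (g t) (f t)]
    rw [hJeq, ← hasSum_zero.unique hsum]
  · rw [Function.onFun, Set.disjoint_left]
    intro t ht ht'
    have h := IsCell.left_eq_of_mem p.2 q.2 ht ht'
    exact hpq (Subtype.ext (Prod.ext h (IsCell.right_unique p.2 (h ▸ q.2))))

/-! ### Continuous representatives -/

/-- The polynomial `p`, transported to `[x, y]` and extended by constants. -/
noncomputable def clampEval (p : ℝ[X]) (x y t : ℝ) : ℝ :=
  p.eval (max 0 (min 1 ((t - x) / (y - x))))

theorem continuous_clampEval (p : ℝ[X]) (x y : ℝ) : Continuous (clampEval p x y) :=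
  p.continuous.comp (by fun_prop)

theorem clampEval_of_le (h : x < y) (p : ℝ[X]) {t : ℝ} (ht : t ≤ x) :
    clampEval p x y t = p.eval 0 := by
  have : (t - x) / (y - x) ≤ 0 := div_nonpos_of_nonpos_of_nonneg (by linarith) (by linarith)
  rw [clampEval, max_eq_left ((min_le_right _ _).trans this)]

theorem clampEval_of_ge (h : x < y) (p : ℝ[X]) {t : ℝ} (ht : y ≤ t) :
    clampEval p x y t = p.eval 1 := by
  have : 1 ≤ (t - x) / (y - x) := by rw [one_le_div (by linarith)]; linarith
  rw [clampEval, min_eq_left this, max_eq_right zero_le_one]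

theorem clampEval_of_mem (h : x < y) (p : ℝ[X]) {t : ℝ} (ht : t ∈ Set.Ico x y) :
    clampEval p x y t = p.eval ((t - x) / (y - x)) := by
  have h0 : 0 ≤ (t - x) / (y - x) := div_nonneg (by linarith [ht.1]) (by linarith)
  have h1 : (t - x) / (y - x) ≤ 1 := by rw [div_le_one (by linarith)]; linarith [ht.2]
  rw [clampEval, min_eq_right h1, max_eq_right h0]

theorem IsCell.right_le_of_ne {x' y' : ℝ} (h : IsCell a x y) (h' : IsCell a x' y')
    (hne : x' ≠ x) : y' ≤ x ∨ y ≤ x' := by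
  rcases hne.lt_or_gt with hlt | hlt
  · exact Or.inl (h'.le_of_lt _ h.left_mem hlt)
  · exact Or.inr (h.le_of_lt _ h'.left_mem hlt)

/-- The values of a clamped polynomial on all cells. -/
theorem clampEval_of_isCell {x' y' t : ℝ} (h : IsCell a x y) (h' : IsCell a x' y')
    (p : ℝ[X]) (ht : t ∈ Set.Ico x' y') :
    (x' = x ∧ clampEval p x y t = p.eval ((t - x') / (y' - x')))
      ∨ (y' ≤ x ∧ clampEval p x y t = p.eval 0) ∨ (y ≤ x' ∧ clampEval p x y t = p.eval 1) := by
  by_cases hx : x' = x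
  · subst hx
    obtain rfl := h.right_unique h'
    exact Or.inl ⟨rfl, clampEval_of_mem h.lt p ht⟩
  · rcases h.right_le_of_ne h' hx with h1 | h1
    · exact Or.inr (Or.inl ⟨h1, clampEval_of_le h.lt p (ht.2.le.trans h1)⟩)
    · exact Or.inr (Or.inr ⟨h1, clampEval_of_ge h.lt p (h1.trans ht.1)⟩)

theorem OmegaIndex.Valid.exists_continuous (hJ : J.OrdConnected) (ha : IsKnotSequence J a)
    {n : ℕ} {e : ℕ → ℝ[X]} (he : IsUnitFamily n e) {k : OmegaIndex} (hk : k.Valid a n) :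
    ∃ g : ℝ → ℝ, Continuous g ∧ ∀ x y, IsCell a x y → ∀ t ∈ Set.Ico x y,
      g t = (labelPoly e (k.label x y)).eval ((t - x) / (y - x)) := by
  cases k with
  | inner x i =>
    obtain ⟨⟨y, hc⟩, hi, -⟩ := hk
    refine ⟨clampEval (e i) x y, continuous_clampEval _ _ _, fun x' y' h' t ht => ?_⟩
    have := h'.lt
    rcases clampEval_of_isCell hc h' (e i) ht with ⟨h1, h2⟩ | ⟨h1, h2⟩ | ⟨h1, h2⟩
    · simp [h2, label, h1, labelPoly]
    · simp [h2, label, (this.trans_le h1).ne, labelPoly, he.eval_zero i hi]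
    · simp [h2, label, (hc.lt.trans_le h1).ne', labelPoly, he.eval_one i hi]
  | hat v =>
    have hleft : ∃ gl : ℝ → ℝ, Continuous gl ∧ ∀ x y, IsCell a x y → ∀ t ∈ Set.Ico x y,
        gl t = if x < v then 1 else (labelPoly e (label x y (hat v))).eval
          ((t - x) / (y - x)) := by
      by_cases hv : (v : EReal) < sSup ((fun t : ℝ => (t : EReal)) '' J)
      · obtain ⟨u, hc⟩ := ha.exists_isCell_right hJ hk hv
        refine ⟨clampEval (e 0) v u, continuous_clampEval _ _ _, fun x' y' h' t ht => ?_⟩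
        have := h'.lt
        rcases clampEval_of_isCell hc h' (e 0) ht with ⟨h1, h2⟩ | ⟨h1, h2⟩ | ⟨h1, h2⟩
        · simp [h2, label, h1, labelPoly]
        · simp [h2, (this.trans_le h1), he.l_zero]
        · have h3 := hc.lt.trans_le h1
          simp [h2, label, h3.not_gt, h3.ne', (h3.trans this).ne', labelPoly, he.l_one]
      · refine ⟨fun _ => 1, continuous_const, fun x' y' h' t ht => ?_⟩
        rw [if_pos]
        exact EReal.coe_lt_coe_iff.1 ((h'.left_lt_sSup ha).trans_le (not_lt.1 hv))
    have hright : ∃ gr : ℝ → ℝ, Continuous gr ∧ ∀ x y, IsCell a x y → ∀ t ∈ Set.Ico x y,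
        gr t = if x < v then (labelPoly e (label x y (hat v))).eval
          ((t - x) / (y - x)) else 1 := by
      by_cases hv : sInf ((fun t : ℝ => (t : EReal)) '' J) < (v : EReal)
      · obtain ⟨u, hc⟩ := ha.exists_isCell_left hJ hk hv
        refine ⟨clampEval (e 1) u v, continuous_clampEval _ _ _, fun x' y' h' t ht => ?_⟩
        have := h'.lt
        rcases clampEval_of_isCell hc h' (e 1) ht with ⟨h1, h2⟩ | ⟨h1, h2⟩ | ⟨h1, h2⟩
        · subst h1
          obtain rfl := hc.right_unique h'
          simp [h2, label, this, this.ne, labelPoly]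
        · have h3 := h1.trans_lt hc.lt
          simp [h2, label, h3.ne, (this.trans h3).ne, this.trans h3, labelPoly, he.r_zero]
        · simp [h2, h1.not_gt, he.r_one]
      · refine ⟨fun _ => 1, continuous_const, fun x' y' h' t ht => ?_⟩
        rw [if_neg]
        exact fun hlt => hv ((sInf_le ⟨x', ha.subset h'.left_mem, rfl⟩ :
          sInf ((fun t : ℝ => (t : EReal)) '' J) ≤ x').trans_lt (EReal.coe_lt_coe_iff.2 hlt))
    obtain ⟨gl, hgl, hl⟩ := hleft
    obtain ⟨gr, hgr, hr⟩ := hright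
    -- Each half of the hat is extended by its peak value `1` across `v`, so on every cell one
    -- summand equals `1` and cancels.
    refine ⟨fun t => gl t + gr t - 1, by fun_prop, fun x y h t ht => ?_⟩
    simp only [hl x y h t ht, hr x y h t ht]
    split_ifs <;> ring

theorem omegaBasis_subset_splineSpace (hJ : J.OrdConnected) (ha : IsKnotSequence J a) {n : ℕ}
    (hn : 1 ≤ n) : omegaBasis J a n ⊆ splineSpace J a (n + 3) := by
  intro f hf
  obtain ⟨e, he⟩ := exists_isUnitFamily hn
  obtain ⟨k, hk, hkf⟩ := exists_represents hJ ha hn he hf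
  obtain ⟨g, hg, hgk⟩ := hk.exists_continuous hJ ha he
  refine ⟨g, hg.continuousOn, ha.ae_of_isCell hJ fun x y h => ?_, fun x hx => ?_⟩
  · filter_upwards [hkf x y h, ae_restrict_mem measurableSet_Ico] with t ht hm
    rw [ht, hgk x y h t hm]
  · by_cases hlt : (x : EReal) < sSup ((fun t : ℝ => (t : EReal)) '' J)
    · obtain ⟨y, hc⟩ := ha.exists_isCell_right hJ hx hlt
      refine ⟨(labelPoly e (k.label x y)).comp (C (y - x)⁻¹ * (X - C x)), ?_,
        fun t _ hxt hty => ?_⟩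
      · refine natDegree_comp_le.trans ?_
        have h1 : (C (y - x)⁻¹ * (X - C x)).natDegree ≤ 1 := by compute_degree
        have h2 : (labelPoly e (k.label x y)).natDegree ≤ n + 3 := by
          rcases k.label x y with _ | i
          · simp [labelPoly]
          · exact he.natDegree_le i
        nlinarith
      · rw [hc.knotSucc_eq] at hty
        rw [hgk x y hc t ⟨hxt.le, EReal.coe_lt_coe_iff.1 hty⟩]
        simp [div_eq_inv_mul]
    · refine ⟨0, by simp, fun t ht hxt _ => absurd ?_ hlt⟩
      exact (EReal.coe_lt_coe_iff.2 hxt).trans_le (le_sSup ⟨t, ht, rfl⟩)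

/-! ### The axioms of a centered basis -/

theorem omegaBasis_ne_zero (hJ : J.OrdConnected) (ha : IsKnotSequence J a) {n : ℕ} (hn : 1 ≤ n)
    {f : L2On J} (hf : f ∈ omegaBasis J a n) : ¬ ∀ᵐ t ∂(volume.restrict J), f t = 0 := by
  obtain ⟨e, he⟩ := exists_isUnitFamily hn
  obtain ⟨k, hk, hkf⟩ := exists_represents hJ ha hn he hf
  obtain ⟨x, y, h, hne⟩ := hk.exists_label_ne_none hJ ha
  intro h0
  exact hne ((hkf.label_eq_none_iff hn he hk h).2
    (ae_mono (Measure.restrict_mono (h.Ico_subset hJ ha) le_rfl) h0))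

/-- Finitely many cells meet a compact interval, and each carries at most one member for each label
up to `n + 1`. -/
theorem locallyFinite_omegaBasis (hJ : J.OrdConnected) (ha : IsKnotSequence J a) {n : ℕ}
    (hn : 1 ≤ n) (c d : ℝ) (hcd : Set.Icc c d ⊆ J) :
    {f | f ∈ omegaBasis J a n ∧
      ¬ ∀ᵐ t ∂(volume.restrict (Set.Icc c d)), f t = 0}.Finite := by
  obtain ⟨e, he⟩ := exists_isUnitFamily hn
  have hF : {p : ℝ × ℝ | IsCell a p.1 p.2 ∧ (Set.Ico p.1 p.2 ∩ Set.Icc c d).Nonempty}.Finite := by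
    have hfst : (Prod.fst '' {p : ℝ × ℝ | IsCell a p.1 p.2 ∧
        (Set.Ico p.1 p.2 ∩ Set.Icc c d).Nonempty}).Finite := by
      have h2 : {x | ∃ y, IsCell a x y ∧ c ∈ Set.Ico x y}.Subsingleton := by
        rintro x ⟨y, h, hm⟩ x' ⟨y', h', hm'⟩
        exact h.left_eq_of_mem h' hm hm'
      refine ((ha.finite_inter_Icc hcd).union h2.finite).subset ?_
      rintro _ ⟨⟨x, y⟩, ⟨h, t, ht, ht'⟩, rfl⟩
      -- The left end of the cell is a knot in `[c, d]`, unless the cell contains `c`, which happens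
      -- for at most one cell.
      by_cases hx : c ≤ x
      · exact Or.inl ⟨h.left_mem, hx, ht.1.trans ht'.2⟩
      · exact Or.inr ⟨y, h, (not_le.1 hx).le, ht'.1.trans_lt ht.2⟩
    refine hfst.of_finite_image ?_
    rintro ⟨x, y⟩ ⟨h, -⟩ ⟨x', y'⟩ ⟨h', -⟩ (rfl : x = x')
    exact Prod.ext rfl (h.right_unique h')
  refine (hF.biUnion fun p _ => (Set.finite_Iic (n + 1)).biUnion (t := fun i =>
    {f : L2On J | ∃ k : OmegaIndex, k.Valid a n ∧ Represents J a e k f ∧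
      k.label p.1 p.2 = some i}) fun i _ => ?_).subset ?_
  · refine Set.Subsingleton.finite ?_
    rintro f ⟨k, hk, hkf, hki⟩ g ⟨l, hl, hlg, hli⟩
    obtain rfl := hk.eq_of_label hl hki hli
    exact hkf.unique hJ ha hlg
  · rintro f ⟨hf, hne⟩
    obtain ⟨k, hk, hkf⟩ := exists_represents hJ ha hn he hf
    have hex : ∃ x y, IsCell a x y ∧ (Set.Ico x y ∩ Set.Icc c d).Nonempty ∧
        k.label x y ≠ none := by
      by_contra! hno
      refine hne ?_
      have h1 : ∀ᵐ t ∂(volume.restrict J), t ∈ Set.Icc c d → f t = 0 := by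
        refine ha.ae_of_isCell hJ fun x y h => ?_
        by_cases hxy : (Set.Ico x y ∩ Set.Icc c d).Nonempty
        · filter_upwards [(hkf.label_eq_none_iff hn he hk h).1 (hno x y h hxy)] with t ht _
          exact ht
        · filter_upwards [ae_restrict_mem measurableSet_Ico] with t ht ht'
          exact absurd ⟨t, ht, ht'⟩ hxy
      filter_upwards [ae_mono (Measure.restrict_mono hcd le_rfl) h1,
        ae_restrict_mem measurableSet_Icc] with t ht hm
      exact ht hm
    obtain ⟨x, y, h, hxy, hlab⟩ := hex
    obtain ⟨i, hi⟩ := Option.ne_none_iff_exists'.1 hlab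
    exact Set.mem_biUnion (x := (x, y)) ⟨h, hxy⟩
      (Set.mem_biUnion (x := i) (hk.label_le hn hi) ⟨k, hk, hkf, hi⟩)

theorem mem_knotPart_of_represents (hJ : J.OrdConnected) (ha : IsKnotSequence J a) {n : ℕ}
    (hn : 1 ≤ n) {e : ℕ → ℝ[X]} (he : IsUnitFamily n e) {k : OmegaIndex} (hk : k.Valid a n)
    {f : L2On J} (hf : f ∈ omegaBasis J a n) (hkf : Represents J a e k f) (h : IsCell a x y)
    (hne : k.label x y ≠ none)
    (hsupp : ∀ x' y', IsCell a x' y' → k.label x' y' ≠ none → x' = x ∨ y' = x) :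
    f ∈ knotPart a (omegaBasis J a n) (x : EReal) := by
  have hpred : knotPred a x ≤ x := sSup_le (by rintro _ ⟨b, ⟨_, hb⟩, rfl⟩; exact hb.le)
  refine ⟨⟨hf, ha.ae_of_isCell hJ fun x' y' h' => ?_⟩, ?_⟩
  · by_cases hlab : k.label x' y' = none
    · filter_upwards [(hkf.label_eq_none_iff hn he hk h').1 hlab] with t ht _
      exact ht
    · filter_upwards [ae_restrict_mem measurableSet_Ico] with t ht hout
      refine absurd ⟨?_, ?_⟩ hout
      · have h1 : (x' : EReal) ≤ t := EReal.coe_le_coe_iff.2 ht.1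
        refine le_trans ?_ h1
        rcases hsupp x' y' h' hlab with rfl | rfl
        · exact hpred
        · rw [h'.knotPred_eq]
      · rw [h.knotSucc_eq]
        refine EReal.coe_le_coe_iff.2 (ht.2.le.trans ?_)
        rcases hsupp x' y' h' hlab with rfl | rfl
        · exact (h'.right_unique h).le
        · exact h.lt.le
  -- A function supported in the cell to the left of `x` would vanish on the cell to its right,
  -- against `hne`.
  · rintro ⟨hbot, -, hz⟩
    by_cases hinf : sInf ((fun t : ℝ => (t : EReal)) '' J) < (x : EReal)
    · obtain ⟨w, hw⟩ := ha.exists_isCell_left hJ h.left_mem hinf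
      rw [hw.knotPred_eq, hw.knotSucc_eq] at hz
      refine hne ((hkf.label_eq_none_iff hn he hk h).2 ?_)
      filter_upwards [ae_mono (Measure.restrict_mono (h.Ico_subset hJ ha) le_rfl) hz,
        ae_restrict_mem measurableSet_Ico, ae_restrict_of_ae (volume.ae_ne x)] with t h1 h2 h3
      refine h1 fun h4 => h3 (le_antisymm ?_ h2.1)
      exact EReal.coe_le_coe_iff.1 h4.2
    · exact hbot (ha.knotPred_eq_bot hinf)

theorem omegaBasis_eq_iUnion (hJ : J.OrdConnected) (ha : IsKnotSequence J a) {n : ℕ}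
    (hn : 1 ≤ n) :
    omegaBasis J a n = ⋃ x ∈ a, knotPart a (omegaBasis J a n) (x : EReal) := by
  refine Set.Subset.antisymm (fun f hf => ?_)
    (Set.iUnion₂_subset fun x _ f hf => hf.1.1)
  obtain ⟨e, he⟩ := exists_isUnitFamily hn
  obtain ⟨k, hk, hkf⟩ := exists_represents hJ ha hn he hf
  obtain ⟨x, y, h, hne, hsupp⟩ : ∃ x y, IsCell a x y ∧ k.label x y ≠ none ∧
      ∀ x' y', IsCell a x' y' → k.label x' y' ≠ none → x' = x ∨ y' = x := by
    cases k with
    | inner x i =>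
      obtain ⟨⟨y, h⟩, -⟩ := hk
      refine ⟨x, y, h, by simp [label], fun x' y' _ hne => Or.inl ?_⟩
      by_contra hx
      simp [label, hx] at hne
    | hat v =>
      by_cases hv : (v : EReal) < sSup ((fun t : ℝ => (t : EReal)) '' J)
      · obtain ⟨u, h⟩ := ha.exists_isCell_right hJ hk hv
        refine ⟨v, u, h, by simp [label], fun x' y' _ hne => ?_⟩
        by_contra! hx
        simp [label, hx.1, hx.2] at hne
      -- At the right end of `J` the hat lives on the last cell only, so it is centered on the left
      -- end of that cell and not on `v`.
      · obtain ⟨x, y, h, hne⟩ := hk.exists_label_ne_none hJ ha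
        have hright : ∀ x' y', IsCell a x' y' → label x' y' (hat v) ≠ none → y' = v := by
          intro x' y' h' hne'
          have hx' : x' ≠ v := by rintro rfl; exact hv (h'.left_lt_sSup ha)
          by_contra hy'
          simp [label, hx', hy'] at hne'
        obtain rfl := hright x y h hne
        refine ⟨x, y, h, hne, fun x' y' h' hne' => Or.inl ?_⟩
        obtain rfl := hright x' y' h' hne'
        exact h'.left_unique h
  exact Set.mem_biUnion h.left_mem
    (mem_knotPart_of_represents hJ ha hn he hk hf hkf h hne hsupp)

/-- Vanishing on `[x, x₊]` would push the support into the neighbouring cell and so place the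
function in the part that the definition removes. At the left end of `J` there is no neighbour, and
the function would be zero. -/
theorem not_ae_zero_of_mem_knotPart_union_barPart (hJ : J.OrdConnected)
    (ha : IsKnotSequence J a) {n : ℕ} (hn : 1 ≤ n) {x : ℝ} (hx : x ∈ a) {f : L2On J}
    (hf : f ∈ knotPart a (omegaBasis J a n) (x : EReal)
      ∪ barPart a (omegaBasis J a n) (knotSucc a x)) :
    ¬ ∀ᵐ t ∂(volume.restrict J), t ∈ realIcc x (knotSucc a x) → f t = 0 := by
  intro h0
  rcases hf with ⟨⟨hf, hs⟩, hb⟩ | ⟨htop, ⟨⟨hf, hs⟩, -⟩, hb⟩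
  · by_cases hinf : sInf ((fun t : ℝ => (t : EReal)) '' J) < (x : EReal)
    · obtain ⟨w, hw⟩ := ha.exists_isCell_left hJ hx hinf
      rw [hw.knotPred_eq] at hs hb
      refine hb ⟨EReal.coe_ne_bot w, hf, ?_⟩
      rw [hw.knotSucc_eq]
      filter_upwards [h0, hs] with t h1 h2 h3
      by_cases h4 : t ∈ realIcc w (knotSucc a x)
      · refine h1 ⟨?_, h4.2⟩
        by_contra hlt
        exact h3 ⟨h4.1, (not_le.1 hlt).le⟩
      · exact h2 h4
    · refine omegaBasis_ne_zero hJ ha hn hf ?_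
      rw [ha.knotPred_eq_bot hinf] at hs
      filter_upwards [h0, hs, ae_restrict_mem hJ.measurableSet] with t h1 h2 h3
      have hxt : (x : EReal) ≤ t := (not_lt.1 hinf).trans (sInf_le ⟨t, h3, rfl⟩)
      by_cases h4 : (t : EReal) ≤ knotSucc a x
      · exact h1 ⟨hxt, h4⟩
      · exact h2 fun h5 => h4 h5.2
  · have hlt : (x : EReal) < sSup ((fun t : ℝ => (t : EReal)) '' J) := by
      by_contra hlt
      exact htop (ha.knotSucc_eq_top hlt)
    obtain ⟨y, hc⟩ := ha.exists_isCell_right hJ hx hlt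
    rw [hc.knotSucc_eq] at h0 hs hb
    rw [hc.knotPred_eq] at hs
    refine hb ⟨EReal.coe_ne_bot y, hf, ?_⟩
    filter_upwards [h0, hs] with t h1 h2 h3
    by_cases h4 : t ∈ realIcc x (knotSucc a y)
    · refine h1 ⟨h4.1, ?_⟩
      by_contra hlt
      exact h3 ⟨(not_le.1 hlt).le, h4.2⟩
    · exact h2 h4

theorem measurableSet_realIcc (u v : EReal) : MeasurableSet (realIcc u v) :=
  (measurableSet_le measurable_const measurable_coe_real_ereal).inter
    (measurableSet_le measurable_coe_real_ereal measurable_const)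

theorem coeFn_restrictTo (K : Set ℝ) (f : L2On J) :
    restrictTo K f =ᵐ[(volume.restrict J).restrict K] f :=
  MemLp.coeFn_toLp _

theorem inner_restrictTo (K : Set ℝ) (f g : L2On J) :
    (inner ℝ (restrictTo K f) (restrictTo K g) : ℝ)
      = ∫ t, f t * g t ∂((volume.restrict J).restrict K) := by
  rw [L2.inner_def]
  refine integral_congr_ae ?_
  filter_upwards [coeFn_restrictTo K f, coeFn_restrictTo K g] with t h1 h2
  rw [h1, h2]
  simp [mul_comm]

/-- The restrictions are nonzero and, by orthogonality on a single cell, mutually orthogonal. -/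
theorem locallyIndependent_omegaBasis (hJ : J.OrdConnected) (ha : IsKnotSequence J a) {n : ℕ}
    (hn : 1 ≤ n) {x : ℝ} (hx : x ∈ a) : LinearIndependent ℝ
      (fun f : ↥(knotPart a (omegaBasis J a n) (x : EReal)
          ∪ barPart a (omegaBasis J a n) (knotSucc a x)) =>
        restrictTo (realIcc x (knotSucc a x)) (f : L2On J)) := by
  have hne : ∀ f : ↥(knotPart a (omegaBasis J a n) (x : EReal)
      ∪ barPart a (omegaBasis J a n) (knotSucc a x)),
      restrictTo (realIcc x (knotSucc a x)) (f : L2On J) ≠ 0 := by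
    intro f h0
    refine not_ae_zero_of_mem_knotPart_union_barPart hJ ha hn hx f.2 ?_
    rw [← ae_restrict_iff' (measurableSet_realIcc _ _)]
    have h1 := coeFn_restrictTo (realIcc x (knotSucc a x)) (f : L2On J)
    rw [h0] at h1
    filter_upwards [h1, Lp.coeFn_zero ℝ 2
      ((volume.restrict J).restrict (realIcc x (knotSucc a x)))] with t h2 h3
    rw [← h2, h3, Pi.zero_apply]
  refine linearIndependent_of_ne_zero_of_inner_eq_zero hne fun f g hfg => ?_
  have hmem : ∀ f : ↥(knotPart a (omegaBasis J a n) (x : EReal)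
      ∪ barPart a (omegaBasis J a n) (knotSucc a x)), (f : L2On J) ∈ omegaBasis J a n := by
    rintro ⟨f, hf | hf⟩
    · exact hf.1.1
    · exact hf.2.1.1.1
  change (inner ℝ (restrictTo _ (f : L2On J)) (restrictTo _ (g : L2On J)) : ℝ) = 0
  rw [inner_restrictTo, Measure.restrict_restrict (measurableSet_realIcc _ _)]
  by_cases hlt : (x : EReal) < sSup ((fun t : ℝ => (t : EReal)) '' J)
  · obtain ⟨y, hc⟩ := ha.exists_isCell_right hJ hx hlt
    have hset : realIcc (x : EReal) (knotSucc a x) = Set.Icc x y := by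
      rw [hc.knotSucc_eq]
      ext t
      simp [realIcc]
    rw [hset, Set.inter_eq_left.2 (hc.Icc_subset hJ ha), integral_Icc_eq_integral_Ico]
    exact setIntegral_mul_eq_zero hJ ha hn (hmem f) (hmem g) (Subtype.coe_ne_coe.2 hfg) hc
  -- At the right end of `J` the set of integration is at most the point `x`.
  · refine setIntegral_measure_zero _ (Set.Subsingleton.measure_zero (fun s hs t ht => ?_) _)
    have hall : ∀ s ∈ realIcc (x : EReal) (knotSucc a x) ∩ J, s = x := fun s hs =>
      le_antisymm (EReal.coe_le_coe_iff.1
        ((le_sSup (Set.mem_image_of_mem (fun t : ℝ => (t : EReal)) hs.2)).trans (not_lt.1 hlt)))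
        (EReal.coe_le_coe_iff.1 hs.1.1)
    rw [hall s hs, hall t ht]

theorem isCenteredBasis_omegaBasis (hJ : J.OrdConnected) (ha : IsKnotSequence J a) {n : ℕ}
    (hn : 1 ≤ n) : IsCenteredBasis a (omegaBasis J a n) :=
  ⟨locallyFinite_omegaBasis hJ ha hn, omegaBasis_eq_iUnion hJ ha hn,
    fun _ hx => locallyIndependent_omegaBasis hJ ha hn hx⟩

/-! ### Nestedness of the spaces -/

theorem onKnot_mem_span_of_mem_innerSpan {n : ℕ} (ha : IsKnotSequence J a) (h : IsCell a x y)
    {f : Lp ℝ 2 (volume : Measure ℝ)} (hf : f ∈ innerSpan n) :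
    onKnot J a f x ∈ Submodule.span ℝ (omegaBasis J a n) := by
  induction hf using Submodule.span_induction with
  | mem u hu =>
    refine Submodule.subset_span ⟨x, h.left_mem, h.left_lt_sSup ha, Or.inl ?_⟩
    rcases hu with rfl | ⟨i, ⟨hi, hi'⟩, rfl⟩
    · exact Or.inl rfl
    · exact Or.inr (Or.inl ⟨i, hi, hi', rfl⟩)
  | zero => rw [onKnot_zero h]; exact zero_mem _
  | add u v _ _ hu hv => rw [onKnot_add h]; exact add_mem hu hv
  | smul c u _ hu => rw [onKnot_smul h]; exact Submodule.smul_mem _ _ hu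

theorem exists_lFun_eq_add {n : ℕ} (hn : 1 ≤ n) :
    ∃ u ∈ innerSpan (n + 3), lFun n = lFun (n + 3) + u :=
  ⟨(innerSpan (n + 3)).starProjection coramp - (innerSpan n).starProjection coramp,
    sub_mem (Submodule.starProjection_apply_mem _ _)
      (innerSpan_le hn (Submodule.starProjection_apply_mem _ _)), by rw [lFun, lFun]; abel⟩

theorem exists_rFun_eq_add {n : ℕ} (hn : 1 ≤ n) :
    ∃ u ∈ innerSpan (n + 3), rFun n = rFun (n + 3) + u :=
  ⟨(innerSpan (n + 3)).starProjection ramp - (innerSpan n).starProjection ramp,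
    sub_mem (Submodule.starProjection_apply_mem _ _)
      (innerSpan_le hn (Submodule.starProjection_apply_mem _ _)), by rw [rFun, rFun]; abel⟩

theorem span_omegaBasis_le (hJ : J.OrdConnected) (ha : IsKnotSequence J a) {n : ℕ}
    (hn : 1 ≤ n) : Submodule.span ℝ (omegaBasis J a n)
      ≤ Submodule.span ℝ (omegaBasis J a (n + 3)) := by
  obtain ⟨ul, hul, hl⟩ := exists_lFun_eq_add hn
  obtain ⟨ur, hur, hr⟩ := exists_rFun_eq_add hn
  refine Submodule.span_le.2 ?_
  rintro f ⟨x, hxa, hx, h⟩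
  obtain ⟨y, hc⟩ := ha.exists_isCell_right hJ hxa hx
  rcases h with (rfl | ⟨i, hi, hi', rfl⟩ | ⟨hinf, rfl⟩ | ⟨hsup, rfl⟩) | ⟨hinf, rfl⟩
  · exact onKnot_mem_span_of_mem_innerSpan ha hc (innerSpan_le hn (zFun_mem_innerSpan n))
  · exact onKnot_mem_span_of_mem_innerSpan ha hc (bump_mem_innerSpan hi (by omega))
  · rw [hl, onKnot_add hc]
    refine add_mem (Submodule.subset_span ⟨x, hxa, hx, Or.inl ?_⟩)
      (onKnot_mem_span_of_mem_innerSpan ha hc hul)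
    exact Or.inr (Or.inr (Or.inl ⟨hinf, rfl⟩))
  · rw [hr, onKnot_add hc]
    refine add_mem (Submodule.subset_span ⟨x, hxa, hx, Or.inl ?_⟩)
      (onKnot_mem_span_of_mem_innerSpan ha hc hur)
    exact Or.inr (Or.inr (Or.inr ⟨hsup, rfl⟩))
  · obtain ⟨w, hw⟩ := ha.exists_isCell_left hJ hxa hinf
    have hmem : omegaBar J a (n + 3) x ∈ Submodule.span ℝ (omegaBasis J a (n + 3)) :=
      Submodule.subset_span ⟨x, hxa, hx, Or.inr ⟨hinf, rfl⟩⟩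
    -- The correction of a hat splits into inner functions on its two cells, so the new hat need not
    -- be taken apart.
    have hsplit : omegaBar J a n x
        = omegaBar J a (n + 3) x + (onKnot J a ur w + onKnot J a ul x) := by
      rw [omegaBar, omegaBar, hw.knotPred_eq, EReal.toReal_coe, hl, hr, onKnot_add hw,
        onKnot_add hc]
      abel
    rw [hsplit]
    exact add_mem hmem (add_mem (onKnot_mem_span_of_mem_innerSpan ha hw hur)
      (onKnot_mem_span_of_mem_innerSpan ha hc hul))

theorem closedSpan_omegaBasis_le (hJ : J.OrdConnected) (ha : IsKnotSequence J a) {n : ℕ}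
    (hn : 1 ≤ n) : closedSpan (omegaBasis J a n) ≤ closedSpan (omegaBasis J a (n + 3)) :=
  Submodule.topologicalClosure_mono (span_omegaBasis_le hJ ha hn)

/-! ### Density of the union -/

theorem inner_onKnot_unitPoly (hJ : J.OrdConnected) (ha : IsKnotSequence J a) (h : IsCell a x y)
    (p : ℝ[X]) (f : L2On J) : (inner ℝ (onKnot J a (unitPoly p) x) f : ℝ)
      = ∫ t in Set.Ico x y, p.eval ((t - x) / (y - x)) * f t := by
  rw [L2.inner_def, ← Set.inter_eq_left.2 (h.Ico_subset hJ ha),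
    ← Measure.restrict_restrict measurableSet_Ico, ← integral_indicator measurableSet_Ico]
  refine integral_congr_ae ?_
  filter_upwards [onKnot_unitPoly (J := J) h p] with t ht
  rw [ht]
  by_cases hm : t ∈ Set.Ico x y <;> simp [hm, mul_comm]

theorem span_range_ultraspherical (lam : ℝ) :
    Submodule.span ℝ (Set.range (ultraspherical lam)) = ⊤ := by
  let S : Polynomial.Sequence ℝ :=
    ⟨ultraspherical lam, fun i => by
      rw [degree_eq_natDegree (ultraspherical_monic_natDegree lam i).1.ne_zero,
        (ultraspherical_monic_natDegree lam i).2]⟩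
  exact S.span fun i => by
    change IsUnit (ultraspherical lam i).leadingCoeff
    rw [(ultraspherical_monic_natDegree lam i).1.leadingCoeff]
    exact isUnit_one

theorem integral_mul_eval_eq_zero_of_bump (hJ : J.OrdConnected) (ha : IsKnotSequence J a)
    (h : IsCell a x y) {f : L2On J}
    (hf : ∀ i, 2 ≤ i → inner ℝ (onKnot J a (bump i) x) f = (0 : ℝ)) (p : ℝ[X]) :
    ∫ t in Set.Ico x y,
      ((t - x) / (y - x) * (1 - (t - x) / (y - x)) * f t) * p.eval t = 0 := by
  have hd : y - x ≠ 0 := (sub_pos.2 h.lt).ne'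
  have key : ∀ q : ℝ[X], (inner ℝ
      (onKnot J a (unitPoly (X * (1 - X) * q.comp (2 * X - 1))) x) f : ℝ) = 0 := by
    intro q
    have hq : q ∈ Submodule.span ℝ (Set.range (ultraspherical (5 / 2))) := by
      rw [span_range_ultraspherical]; trivial
    induction hq using Submodule.span_induction with
    | mem u hu =>
      obtain ⟨i, rfl⟩ := hu
      exact hf (i + 2) (by omega)
    | zero => rw [inner_onKnot_unitPoly hJ ha h]; simp
    | add u v _ _ hu hv =>
      rw [add_comp, mul_add, unitPoly_add, onKnot_add h, inner_add_left, hu, hv, add_zero]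
    | smul c u _ hu =>
      rw [smul_comp, mul_smul_comm, unitPoly_smul, onKnot_smul h, inner_smul_left, hu, mul_zero]
  -- The inverse of the map from the cell to `[-1, 1]`, so that composition returns `p` in the
  -- variable `t`.
  have := key (p.comp (C x + C ((y - x) / 2) * (X + 1)))
  rw [inner_onKnot_unitPoly hJ ha h] at this
  rw [← this]
  congr 1
  ext t
  have e : x + (y - x) / 2 * (2 * ((t - x) / (y - x)) - 1 + 1) = t := by
    field_simp; ring
  simp only [eval_mul, eval_comp, eval_add, eval_sub, eval_X, eval_one, eval_C, eval_ofNat, e]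
  ring

/-- An integrable function on an interval which is orthogonal to all polynomials vanishes. -/
theorem ae_eq_zero_of_integral_mul_eval_eq_zero {g : ℝ → ℝ}
    (hg : IntegrableOn g (Set.Ico x y))
    (h : ∀ p : ℝ[X], ∫ t in Set.Ico x y, g t * p.eval t = 0) :
    ∀ᵐ t ∂(volume.restrict (Set.Ico x y)), g t = 0 := by
  have hcont : ∀ φ : ℝ → ℝ, Continuous φ → ∫ t in Set.Ico x y, g t * φ t = 0 := by
    intro φ hφ
    have hbdd : ∀ ψ : ℝ → ℝ, Continuous ψ → IntegrableOn (fun t => g t * ψ t) (Set.Ico x y) := by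
      intro ψ hψ
      obtain ⟨c, hc⟩ := (isCompact_Icc (a := x) (b := y)).exists_bound_of_continuousOn
        hψ.continuousOn
      refine Integrable.mul_bdd (c := c) hg hψ.aestronglyMeasurable ?_
      exact (ae_restrict_mem measurableSet_Ico).mono fun t ht =>
        hc t (Set.Ico_subset_Icc_self ht)
    by_contra hne
    set N := ∫ t in Set.Ico x y, ‖g t‖ with hN
    have hN0 : 0 ≤ N := integral_nonneg fun t => norm_nonneg _
    have hpos : 0 < ‖∫ t in Set.Ico x y, g t * φ t‖ := norm_pos_iff.2 hne
    -- With this tolerance the error is at most `N / (N + 1)` times the integral itself, which is a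
    -- contradiction.
    obtain ⟨p, hp⟩ := exists_polynomial_near_of_continuousOn x y φ hφ.continuousOn
      (‖∫ t in Set.Ico x y, g t * φ t‖ / (N + 1)) (by positivity)
    have h1 : ∫ t in Set.Ico x y, g t * φ t = ∫ t in Set.Ico x y, g t * (φ t - p.eval t) := by
      simp_rw [mul_sub]
      rw [integral_sub (hbdd φ hφ) (hbdd _ p.continuous), h p, sub_zero]
    have h2 : ‖∫ t in Set.Ico x y, g t * (φ t - p.eval t)‖
        ≤ ∫ t in Set.Ico x y, ‖g t‖ * (‖∫ t in Set.Ico x y, g t * φ t‖ / (N + 1)) := by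
      refine norm_integral_le_of_norm_le (hg.norm.mul_const _) ?_
      filter_upwards [ae_restrict_mem measurableSet_Ico] with t ht
      rw [norm_mul]
      refine mul_le_mul_of_nonneg_left ?_ (norm_nonneg _)
      rw [norm_sub_rev]
      exact (hp t (Set.Ico_subset_Icc_self ht)).le
    rw [← h1, integral_mul_const, ← hN] at h2
    have h3 : N * (‖∫ t in Set.Ico x y, g t * φ t‖ / (N + 1))
        < ‖∫ t in Set.Ico x y, g t * φ t‖ := by
      rw [mul_div_assoc', div_lt_iff₀ (by positivity)]
      nlinarith
    exact h2.not_gt h3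
  have hIoo := (isOpen_Ioo (a := x) (b := y)).ae_eq_zero_of_integral_contDiff_smul_eq_zero
    (f := g) (μ := volume.restrict (Set.Ico x y)) ?_ ?_
  · filter_upwards [hIoo, ae_restrict_mem measurableSet_Ico,
      ae_restrict_of_ae (volume.ae_ne x)] with t h1 h2 h3
    exact h1 ⟨lt_of_le_of_ne h2.1 h3.symm, h2.2⟩
  · exact (Integrable.locallyIntegrable hg).locallyIntegrableOn _
  · intro φ hφ _ _
    simp_rw [smul_eq_mul, mul_comm (φ _)]
    exact hcont φ hφ.continuous

theorem ae_eq_zero_of_inner_bump_eq_zero (hJ : J.OrdConnected) (ha : IsKnotSequence J a)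
    (h : IsCell a x y) {f : L2On J}
    (hf : ∀ i, 2 ≤ i → inner ℝ (onKnot J a (bump i) x) f = (0 : ℝ)) :
    ∀ᵐ t ∂(volume.restrict (Set.Ico x y)), f t = 0 := by
  have hd : 0 < y - x := sub_pos.2 h.lt
  have hfi : IntegrableOn f (Set.Ico x y) := by
    have hm : MemLp f 2 (volume.restrict (Set.Ico x y)) :=
      (Lp.memLp f).mono_measure (Measure.restrict_mono (h.Ico_subset hJ ha) le_rfl)
    exact hm.integrable (by norm_num)
  have hint : IntegrableOn (fun t => (t - x) / (y - x) * (1 - (t - x) / (y - x)) * f t)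
      (Set.Ico x y) := by
    have hcont : Continuous fun t : ℝ => (t - x) / (y - x) * (1 - (t - x) / (y - x)) := by
      fun_prop
    obtain ⟨c, hc⟩ := (isCompact_Icc (a := x) (b := y)).exists_bound_of_continuousOn
      hcont.continuousOn
    refine Integrable.bdd_mul (c := c) hfi hcont.aestronglyMeasurable ?_
    exact (ae_restrict_mem measurableSet_Ico).mono fun t ht =>
      hc t (Set.Ico_subset_Icc_self ht)
  have h0 := ae_eq_zero_of_integral_mul_eval_eq_zero hint
    (integral_mul_eval_eq_zero_of_bump hJ ha h hf)
  filter_upwards [h0, ae_restrict_mem measurableSet_Ico,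
    ae_restrict_of_ae (volume.ae_ne x)] with t h1 h2 h3
  have hxt : x < t := lt_of_le_of_ne h2.1 h3.symm
  have hp : 0 < (t - x) / (y - x) := div_pos (sub_pos.2 hxt) hd
  have hq : (t - x) / (y - x) < 1 := (div_lt_one hd).2 (by linarith [h2.2])
  exact (mul_eq_zero.1 h1).resolve_left (mul_pos hp (by linarith)).ne'

theorem dense_iUnion_closedSpan_omegaBasis (hJ : J.OrdConnected) (ha : IsKnotSequence J a)
    {κ : ℕ} (hκ : 1 ≤ κ) :
    Dense (⋃ k : ℕ, (closedSpan (omegaBasis J a (3 * k + κ)) : Set (L2On J))) := by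
  have hmono : Monotone fun k : ℕ => closedSpan (omegaBasis J a (3 * k + κ)) := by
    refine monotone_nat_of_le_succ fun k => ?_
    rw [show 3 * (k + 1) + κ = 3 * k + κ + 3 by ring]
    exact closedSpan_omegaBasis_le hJ ha (by omega)
  rw [← Submodule.coe_iSup_of_directed _ hmono.directed_le,
    Submodule.dense_iff_topologicalClosure_eq_top, Submodule.topologicalClosure_eq_top_iff,
    Submodule.eq_bot_iff]
  intro f hf
  rw [Submodule.mem_orthogonal] at hf
  rw [Lp.eq_zero_iff_ae_eq_zero]
  refine ha.ae_of_isCell hJ fun x y h => ae_eq_zero_of_inner_bump_eq_zero hJ ha h fun i hi => ?_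
  -- Level `i` suffices for the bump of index `i`, as `i ≤ 3 * i + κ`.
  refine hf _ (Submodule.mem_iSup_of_mem i (Submodule.le_topologicalClosure _ ?_))
  exact onKnot_mem_span_of_mem_innerSpan ha h (bump_mem_innerSpan hi (by omega))

end

theorem proposition1p2 (J a : Set ℝ) (hJ : J.OrdConnected) (ha : IsKnotSequence J a)
    (κ : ℕ) (hκ : κ = 1 ∨ κ = 2 ∨ κ = 3) :
    (∀ k : ℕ, closedSpan (omegaBasis J a (3 * k + κ))
      ≤ closedSpan (omegaBasis J a (3 * (k + 1) + κ))) ∧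
    (∀ k : ℕ,
      IsCenteredBasis a (omegaBasis J a (3 * k + κ)) ∧
      (omegaBasis J a (3 * k + κ)).Pairwise (fun f g => inner ℝ f g = 0) ∧
      omegaBasis J a (3 * k + κ) ⊆ splineSpace J a (3 * k + κ + 3)) ∧
    Dense (⋃ k : ℕ, (closedSpan (omegaBasis J a (3 * k + κ)) : Set (L2On J))) := by
  have hκ1 : 1 ≤ κ := by omega
  refine ⟨fun k => ?_, fun k => ?_, dense_iUnion_closedSpan_omegaBasis hJ ha hκ1⟩
  · rw [show 3 * (k + 1) + κ = 3 * k + κ + 3 by ring]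
    exact closedSpan_omegaBasis_le hJ ha (by omega)
  · have hn : 1 ≤ 3 * k + κ := by omega
    exact ⟨isCenteredBasis_omegaBasis hJ ha hn,
      fun f hf g hg hfg => inner_omegaBasis_eq_zero hJ ha hn hf hg hfg,
      omegaBasis_subset_splineSpace hJ ha hn⟩
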